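/- Let $n\ge 3$, let $\epsilon\in\{1,-1\}$, and let $\mathbb Q_\epsilon^n$ be the simply connected space form of constant sectional curvature $\epsilon$ (the unit sphere $\mathbb S^n$ if $\epsilon=1$, hyperbolic space $\mathbb H^n$ if $\epsilon=-1$), with distance function $d$. Endow $\mathbb Q_\epsilon^n\times\mathbb R$ with the product metric, fix a point $o\in\mathbb Q_\epsilon^n$, and call $\{o\}\times\mathbb R$ the axis. A hypersurface of $\mathbb Q_\epsilon^n\times\mathbb R$ is called rotational (about this axis) if it is a union of sets $S_s(o)\times\{t\}$, where $S_s(o)=\{x\in\mathbb Q^n_\epsilon : d(x,o)=s\}$. For a hypersurface with local unit normal $N$ and principal curvatures $k_1,\dots,k_n$, let $\Theta=\langle N,\partial_t\rangle$ be its angle function, let $T=\partial_t-\Theta N$ be the gradient of its height function (the restriction of the projection to $\mathbb R$), and put $$W_S(k_1,\dots,k_n,\Theta^2)=2\sum_{i<j}k_ik_j+\epsilon(n-1)(2\Theta^2+n-2).$$ The integral curves of $T$ are called $T$-trajectories. Let $\tan_\epsilon,\sin_\epsilon,\cos_\epsilon$ denote $\tan,\sin,\cos$ if $\epsilon=1$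 and $\tanh,\sinh,\cosh$ if $\epsilon=-1$, and let $\mathcal R_1=\pi/2$, $\mathcal R_{-1}=+\infty$. Given $c>\epsilon n(n-1)$, set $$\mathfrak C_n=\frac{c-\epsilon n(n-1)}{n(n-1)},\qquad \delta_\epsilon(c)=\sup\{\lambda\in(0,\mathcal R_\epsilon) : (n\mathfrak C_n+2\epsilon)\tan_\epsilon^2(\lambda)<n-2\}.$$ An unduloid with axis $\{o\}\times\mathbb R$ is a curve of the form $\{(\exp_o(r(t)v),t): t\in\mathbb R\}$, where $v$ is a unit tangent vector of $\mathbb Q_\epsilon^n$ at $o$ and $r:\mathbb R\to(0,\mathcal R_\epsilon)$ is a $C^\infty$ function for which there are $t_0\in\mathbb R$ and $h>0$ such that $r(t+2h)=r(t)$ and $r(t_0-t)=r(t_0+t)$ for all $t$, and $r$ is strictly increasing on $[t_0,t_0+h]$. **Theorem.** Let $c>\epsilon n(n-1)$. Then $\delta_\epsilon(c)\in(0,+\infty]$, and there is a one-parameter family $\{\Sigma(\lambda) : \lambda\in(0,\delta_\epsilon(c))\}$ of properly embedded $C^\infty$ rotational hypersurfaces of $\mathbb Q_\epsilon^n\times\mathbb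 R$, each homeomorphic to $\mathbb S^{n-1}\times\mathbb R$, such that on each $\Sigma(\lambda)$ one has $W_S(k_1,\dots,k_n,\Theta^2)=c$ and the (non-normalized, intrinsic) scalar curvature of $\Sigma(\lambda)$ is constant equal to $c$. The parameter $\lambda$ is the radius of the neck at height $0$: $\Sigma(\lambda)\cap(\mathbb Q_\epsilon^n\times\{0\})=S_\lambda(o)\times\{0\}$, and $d(x,o)\ge\lambda$ for all $(x,t)\in\Sigma(\lambda)$. Moreover: 1. If $\epsilon=1$, or if $\epsilon=-1$ and $\mathfrak C_n>1$, then each $\Sigma(\lambda)$ is Delaunay-type: it is invariant under the vertical translation $(x,t)\mapsto(x,t+a)$ for some $a>0$, through each of its points there passes a $T$-trajectory defined on all of $\mathbb R$, and (the image of) each such $T$-trajectory is an unduloid with axis $\{o\}\times\mathbb R$. 2. If $\epsilon=-1$ and $\mathfrak C_n\le 1$, then each $\Sigma(\lambda)$ is symmetric with respect to $\mathbb H^n\times\{0\}$ and has unbounded height function. -/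

import Mathlib

open scoped ContDiff

noncomputable section

namespace CSCAnnuli

/-! ### Trigonometric functions attached to the curvature `ε = ±1` -/

/-- `sin_ε`: the sine for `ε = 1`, the hyperbolic sine otherwise (`ε = -1`). -/
def sinE (ε s : ℝ) : ℝ := if ε = 1 then Real.sin s else Real.sinh s

/-- `cos_ε`. -/
def cosE (ε s : ℝ) : ℝ := if ε = 1 then Real.cos s else Real.cosh s

/-- `tan_ε`. -/
def tanE (ε s : ℝ) : ℝ := if ε = 1 then Real.tan s else Real.tanh s

/-! ### The space form `Q_ε^n` and the Riemannian product `Q_ε^n × ℝ` -/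

/-- The bilinear form `ε x₀ y₀ + x₁ y₁ + ⋯ + xₙ yₙ` on `ℝ^{n+1}`: Euclidean for `ε = 1`,
Lorentzian for `ε = -1`. -/
def form {n : ℕ} (ε : ℝ) (x y : Fin (n + 1) → ℝ) : ℝ :=
  ε * x 0 * y 0 + ∑ i : Fin n, x i.succ * y i.succ

/-- The simply connected space form of constant curvature `ε = ±1`: the unit sphere
`⟨x, x⟩ = 1` for `ε = 1`, the upper sheet of the hyperboloid `⟨x, x⟩ = -1` for `ε = -1`.
Its Riemannian metric is the restriction of `form ε` to the tangent spaces. -/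
def spaceForm (ε : ℝ) (n : ℕ) : Set (Fin (n + 1) → ℝ) :=
  {x | form ε x x = ε ∧ (ε = -1 → 0 < x 0)}

/-- The Riemannian distance of `spaceForm ε n`. -/
def geoDist {n : ℕ} (ε : ℝ) (x y : Fin (n + 1) → ℝ) : ℝ :=
  if ε = 1 then Real.arccos (form ε x y) else Real.arcosh (-form ε x y)

/-- The vector space that contains `Q_ε^n × ℝ`; the second coordinate is the height. -/
abbrev Ambient (n : ℕ) : Type := (Fin (n + 1) → ℝ) × ℝ

/-- The flat product form on `ℝ^{n+1} × ℝ`. Its restriction to the tangent spaces of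
`Q_ε^n × ℝ` is the Riemannian product metric. -/
def prodForm {n : ℕ} (ε : ℝ) (p q : Ambient n) : ℝ := form ε p.1 q.1 + p.2 * q.2

/-- `Q_ε^n × ℝ`. -/
def productSpace (ε : ℝ) (n : ℕ) : Set (Ambient n) := {p | p.1 ∈ spaceForm ε n}

/-! ### Embedded hypersurfaces -/

/-- `ψ : U → S` is a smooth regular parametrization of a relatively open piece of `S`. -/
structure IsLocalParametrization {n : ℕ} (S : Set (Ambient n)) (U : Set (Fin n → ℝ))
    (ψ : (Fin n → ℝ) → Ambient n) : Prop where
  isOpen : IsOpen U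
  smooth : ContDiffOn ℝ ∞ ψ U
  immersion : ∀ u ∈ U, Function.Injective (fderiv ℝ ψ u)
  embedding : Topology.IsEmbedding (fun u : U => ψ u)
  image : ∃ V : Set (Ambient n), IsOpen V ∧ ψ '' U = S ∩ V

/-- `S` is a properly embedded smooth hypersurface of `Q_ε^n × ℝ`: an `n`-dimensional embedded
submanifold that is a closed subset. -/
structure IsProperlyEmbeddedHypersurface {n : ℕ} (ε : ℝ) (S : Set (Ambient n)) : Prop where
  subset : S ⊆ productSpace ε n
  isClosed : IsClosed S
  exists_param : ∀ p ∈ S, ∃ (U : Set (Fin n → ℝ)) (ψ : (Fin n → ℝ) → Ambient n),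
    IsLocalParametrization S U ψ ∧ p ∈ ψ '' U

/-- The partial derivative `∂ᵢ f` at `u`. -/
def pderiv {n : ℕ} {F : Type*} [NormedAddCommGroup F] [NormedSpace ℝ F] (i : Fin n)
    (f : (Fin n → ℝ) → F) (u : Fin n → ℝ) : F :=
  fderiv ℝ f u (Pi.single i 1)

/-- The coefficients `g_{ij} = ⟨∂ᵢψ, ∂ⱼψ⟩` of the metric induced by `Q_ε^n × ℝ`. -/
def inducedMetric {n : ℕ} (ε : ℝ) (ψ : (Fin n → ℝ) → Ambient n) (u : Fin n → ℝ) :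
    Matrix (Fin n) (Fin n) ℝ :=
  Matrix.of fun i j => prodForm ε (pderiv i ψ u) (pderiv j ψ u)

/-! ### Intrinsic scalar curvature -/

/-- The Christoffel symbol `Γ^k_{ij}` of the metric `g`. -/
def christoffel {n : ℕ} (g : (Fin n → ℝ) → Matrix (Fin n) (Fin n) ℝ) (k i j : Fin n)
    (u : Fin n → ℝ) : ℝ :=
  (1 / 2) * ∑ l, (g u)⁻¹ k l *
    (pderiv i (fun v => g v j l) u + pderiv j (fun v => g v i l) u
      - pderiv l (fun v => g v i j) u)

/-- The coefficient of `∂ₗ` in `R(∂ᵢ, ∂ⱼ)∂ₖ`, where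
`R(X, Y)Z = ∇_X ∇_Y Z - ∇_Y ∇_X Z - ∇_{[X,Y]} Z`. -/
def riemann {n : ℕ} (g : (Fin n → ℝ) → Matrix (Fin n) (Fin n) ℝ) (l k i j : Fin n)
    (u : Fin n → ℝ) : ℝ :=
  pderiv i (christoffel g l j k) u - pderiv j (christoffel g l i k) u
    + ∑ m, (christoffel g l i m u * christoffel g m j k u
      - christoffel g l j m u * christoffel g m i k u)

/-- `Ric(∂ⱼ, ∂ₖ)`, the trace of `Z ↦ R(Z, ∂ⱼ)∂ₖ`. -/
def ricci {n : ℕ} (g : (Fin n → ℝ) → Matrix (Fin n) (Fin n) ℝ) (j k : Fin n)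
    (u : Fin n → ℝ) : ℝ :=
  ∑ i, riemann g i k i j u

/-- The (non normalized) scalar curvature `∑ g^{jk} Ric(∂ⱼ, ∂ₖ)` of the metric `g`. -/
def scalarCurvature {n : ℕ} (g : (Fin n → ℝ) → Matrix (Fin n) (Fin n) ℝ)
    (u : Fin n → ℝ) : ℝ :=
  ∑ j, ∑ k, (g u)⁻¹ j k * ricci g j k u

/-- The scalar curvature of the hypersurface `S`, with the metric induced by `Q_ε^n × ℝ`, is
equal to `c` at every point. (Scalar curvature does not depend on the parametrization.) -/
def HasConstantScalarCurvature {n : ℕ} (ε : ℝ) (S : Set (Ambient n)) (c : ℝ) : Prop :=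
  ∀ p ∈ S, ∃ (U : Set (Fin n → ℝ)) (ψ : (Fin n → ℝ) → Ambient n) (u : Fin n → ℝ),
    IsLocalParametrization S U ψ ∧ u ∈ U ∧ ψ u = p ∧
      scalarCurvature (inducedMetric ε ψ) u = c

/-! ### Principal curvatures and Weingarten hypersurfaces -/

/-- `N` is a smooth unit normal field along `ψ`, tangent to `Q_ε^n × ℝ`. -/
structure IsUnitNormal {n : ℕ} (ε : ℝ) (U : Set (Fin n → ℝ)) (ψ N : (Fin n → ℝ) → Ambient n) :
    Prop where
  smooth : ContDiffOn ℝ ∞ N U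
  unit : ∀ u ∈ U, prodForm ε (N u) (N u) = 1
  tangent : ∀ u ∈ U, form ε (N u).1 (ψ u).1 = 0
  normal : ∀ u ∈ U, ∀ i, prodForm ε (N u) (pderiv i ψ u) = 0

/-- The second fundamental form `⟨A ∂ᵢψ, ∂ⱼψ⟩ = -⟨∇_{∂ᵢ} N, ∂ⱼψ⟩`. The Levi-Civita connection of
`Q_ε^n × ℝ` is the tangential part of the flat derivative, so that the latter may be used. -/
def secondFundamentalForm {n : ℕ} (ε : ℝ) (ψ N : (Fin n → ℝ) → Ambient n) (u : Fin n → ℝ) :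
    Matrix (Fin n) (Fin n) ℝ :=
  Matrix.of fun i j => -prodForm ε (pderiv i N u) (pderiv j ψ u)

/-- The matrix of the shape operator `A` in the basis `∂₁ψ, …, ∂ₙψ`. -/
def shapeOperator {n : ℕ} (ε : ℝ) (ψ N : (Fin n → ℝ) → Ambient n) (u : Fin n → ℝ) :
    Matrix (Fin n) (Fin n) ℝ :=
  (inducedMetric ε ψ u)⁻¹ * secondFundamentalForm ε ψ N u

/-- `k₁, …, kₙ` are the principal curvatures at `u`: the eigenvalues of the shape operator,
with multiplicities. -/
def ArePrincipalCurvatures {n : ℕ} (ε : ℝ) (ψ N : (Fin n → ℝ) → Ambient n) (u : Fin n → ℝ)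
    (k : Fin n → ℝ) : Prop :=
  (shapeOperator ε ψ N u).charpoly = ∏ i, (Polynomial.X - Polynomial.C (k i))

/-- The angle function `Θ = ⟨N, ∂ₜ⟩`. -/
def angle {n : ℕ} (ε : ℝ) (N : (Fin n → ℝ) → Ambient n) (u : Fin n → ℝ) : ℝ :=
  prodForm ε (N u) (0, 1)

/-- The principal curvatures and the angle function of `S` satisfy
`W(k₁, …, kₙ, Θ²) = c` at every point. -/
def IsWeingartenHypersurface {n : ℕ} (ε : ℝ) (S : Set (Ambient n))
    (W : (Fin n → ℝ) → ℝ → ℝ) (c : ℝ) : Prop :=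
  ∀ p ∈ S, ∃ (U : Set (Fin n → ℝ)) (ψ N : (Fin n → ℝ) → Ambient n) (u k : Fin n → ℝ),
    IsLocalParametrization S U ψ ∧ IsUnitNormal ε U ψ N ∧ u ∈ U ∧ ψ u = p ∧
      ArePrincipalCurvatures ε ψ N u k ∧ W k (angle ε N u ^ 2) = c

/-- `W_S(k₁, …, kₙ, θ²) = 2 H₂ + ε (n - 1) (2 θ² + n - 2)` with `H₂ = ∑_{i < j} kᵢ kⱼ`. -/
def scalarWeingarten {n : ℕ} (ε : ℝ) (k : Fin n → ℝ) (θsq : ℝ) : ℝ :=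
  2 * (∑ i, ∑ j ∈ Finset.Ioi i, k i * k j) + ε * ((n : ℝ) - 1) * (2 * θsq + (n : ℝ) - 2)

/-! ### Rotational hypersurfaces, trajectories of the height gradient, unduloids -/

/-- `S` is rotational with axis `{o} × ℝ`: a union of horizontal geodesic spheres centred
on the axis. -/
def IsRotational {n : ℕ} (ε : ℝ) (o : Fin (n + 1) → ℝ) (S : Set (Ambient n)) : Prop :=
  ∀ x t, (x, t) ∈ S → ∀ y ∈ spaceForm ε n, geoDist ε y o = geoDist ε x o → (y, t) ∈ S

/-- The tangent space of `S` at `p`, as the set of velocities of curves in `S`. -/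
def tangentVectors {n : ℕ} (S : Set (Ambient n)) (p : Ambient n) : Set (Ambient n) :=
  {w | ∃ γ : ℝ → Ambient n, (∀ s, γ s ∈ S) ∧ γ 0 = p ∧ HasDerivAt γ w 0}

/-- `w` is the value at `p` of `T`, the gradient on `S` of the height function. -/
def IsHeightGradient {n : ℕ} (ε : ℝ) (S : Set (Ambient n)) (p w : Ambient n) : Prop :=
  w ∈ tangentVectors S p ∧ ∀ v ∈ tangentVectors S p, prodForm ε w v = v.2

/-- `γ : ℝ → S` is a (complete) integral curve of `T`. -/
def IsTTrajectory {n : ℕ} (ε : ℝ) (S : Set (Ambient n)) (γ : ℝ → Ambient n) : Prop :=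
  ∀ s, γ s ∈ S ∧ ∃ w, HasDerivAt γ w s ∧ IsHeightGradient ε S (γ s) w

/-- `C` is an unduloid with axis `{o} × ℝ`: in the vertical half-plane over a geodesic ray
`s ↦ exp_o (s v)`, the curve at distance `r(t)` from the axis at height `t`, where `r` is smooth,
positive, periodic, symmetric about its minima and maxima, and strictly monotone between
consecutive ones. For `ε = 1` the curve lies over an open hemisphere centred at `o`. -/
def IsUnduloid {n : ℕ} (ε : ℝ) (o : Fin (n + 1) → ℝ) (C : Set (Ambient n)) : Prop :=
  ∃ (v : Fin (n + 1) → ℝ) (r : ℝ → ℝ) (t₀ h : ℝ),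
    form ε v v = 1 ∧ form ε v o = 0 ∧ 0 < h ∧
    ContDiff ℝ ∞ r ∧ (∀ t, 0 < r t) ∧ (ε = 1 → ∀ t, r t < Real.pi / 2) ∧
    (∀ t, r (t + 2 * h) = r t) ∧ (∀ t, r (t₀ - t) = r (t₀ + t)) ∧
    StrictMonoOn r (Set.Icc t₀ (t₀ + h)) ∧
    C = Set.range fun t : ℝ => (cosE ε (r t) • o + sinE ε (r t) • v, t)

/-- Delaunay-type: vertically periodic, and the `T`-trajectories (one through each
point) are unduloids. -/
structure IsDelaunayType {n : ℕ} (ε : ℝ) (o : Fin (n + 1) → ℝ) (S : Set (Ambient n)) :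
    Prop where
  periodic : ∃ a : ℝ, 0 < a ∧ ∀ x t, (x, t + a) ∈ S ↔ (x, t) ∈ S
  exists_trajectory : ∀ p ∈ S, ∃ γ, IsTTrajectory ε S γ ∧ γ 0 = p
  unduloid : ∀ γ, IsTTrajectory ε S γ → IsUnduloid ε o (Set.range γ)

/-! ### Constants -/

/-- `C_n = (c - ε n (n - 1)) / (n (n - 1))`. -/
def constC (ε : ℝ) (n : ℕ) (c : ℝ) : ℝ :=
  (c - ε * n * ((n : ℝ) - 1)) / (n * ((n : ℝ) - 1))

/-- `δ_ε(c)`, the supremum (possibly `∞`) of the `l > 0`, with `l < π / 2` if `ε = 1`, such that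
`(n C_n + 2 ε) tan_ε² l < n - 2`. -/
def deltaE (ε : ℝ) (n : ℕ) (c : ℝ) : EReal :=
  sSup ((fun l : ℝ => (l : EReal)) '' {l : ℝ | 0 < l ∧ (ε = 1 → l < Real.pi / 2) ∧
    (n * constC ε n c + 2 * ε) * tanE ε l ^ 2 < (n : ℝ) - 2})

end CSCAnnuli

end

/-!
A rotational hypersurface over a height function is determined by its profile `r`: the section at
height `t` is the geodesic sphere of radius `r t` about the axis. Write `s = sin_ε r`,
`c = cos_ε r`, `v² = 1 + r'²`. The principal curvatures are `c / (s v)`, of multiplicity `n - 1`,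
and `-r'' / v³`, and `Θ = r' / v`, so that with `C = constC ε n c₀` the equation `W_S = c₀` is the
ordinary differential equation of `IsCSCProfile`. It has the first integral
`(1 + r'²) (C sⁿ + G₀) = sⁿ⁻² c²`, which in terms of `y = s` reads
`y'² (C yⁿ + G₀) = (1 - ε y²) (G y - G₀)` with `G y = yⁿ⁻² (1 - K y²)`, `K = C + ε` and
`G₀ = G (sin_ε l)` for a neck of radius `l`. The condition `l < deltaE ε n c₀` says precisely that
the neck lies to the left of the maximum of `G` on the positive axis. If `K > 0` (which is the case
for `ε = 1`, and for `ε = -1` iff `C > 1`), then `G - G₀` has a second simple zero and the profile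
oscillates between the two radii; if `K ≤ 0`, then `G` is increasing and the profile grows on both
sides of the neck.

No existence theorem for differential equations is used. One puts `y = M - a cos θ` between the two
zeros, respectively `y = y₀ cosh θ`; then `dt / dθ` is a smooth positive function bounded below
(`exists_second_root` and `sum_pow_mul_pow_le` are used for this), its primitive is a
diffeomorphism of the line (`exists_timeChange`), and its parity and periodicity give those of `r`
(`exists_periodic_profile`, `exists_unbounded_profile`). Differentiating the first integral
yields `r'` times the profile equation, and the factor `r'` is removed by density
(`profile_ode_of_first_integral`).

For the geometry, the hypersurface has a single chart `chart`, defined on an annulus of `ℝⁿ`, that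
is conformal. Its induced metric is `F • 1`, and the intrinsic scalar curvature comes from the
formula for conformally flat metrics (`scalarCurvature_conformal`); the shape operator is
`α • 1 + β • u uᵀ`, whose characteristic polynomial is explicit. Finally the gradient of the height
is the velocity of the meridians divided by `v²`; its integral curves keep their direction
constant and run through the whole meridian (`range_isTTrajectory`), which is an unduloid when `r`
is periodic (`isDelaunayType_rotSurface`).
-/

namespace CSCAnnuli

/-! ### The functions `sin_ε` and `cos_ε` -/

section Trig

variable {ε : ℝ}

lemma cosE_sq_add (hε : ε = 1 ∨ ε = -1) (s : ℝ) :
    cosE ε s ^ 2 + ε * sinE ε s ^ 2 = 1 := by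
  rcases hε with rfl | rfl
  · simp [cosE, sinE]
  · norm_num [cosE, sinE]
    linarith [Real.cosh_sq s]

lemma hasDerivAt_sinE (s : ℝ) : HasDerivAt (sinE ε) (cosE ε s) s := by
  by_cases h : ε = 1
  · have : sinE ε = Real.sin := by ext; simp [sinE, h]
    rw [this, cosE, if_pos h]; exact Real.hasDerivAt_sin s
  · have : sinE ε = Real.sinh := by ext; simp [sinE, h]
    rw [this, cosE, if_neg h]; exact Real.hasDerivAt_sinh s

lemma hasDerivAt_cosE (hε : ε = 1 ∨ ε = -1) (s : ℝ) :
    HasDerivAt (cosE ε) (-ε * sinE ε s) s := by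
  rcases hε with rfl | rfl
  · have : cosE 1 = Real.cos := by ext; simp [cosE]
    simpa [this, sinE] using Real.hasDerivAt_cos s
  · have : cosE (-1) = Real.cosh := by ext; norm_num [cosE]
    norm_num [this, sinE]
    exact Real.hasDerivAt_cosh s

lemma contDiff_sinE : ContDiff ℝ ∞ (sinE ε) := by
  by_cases h : ε = 1
  · have : sinE ε = Real.sin := by ext; simp [sinE, h]
    rw [this]; exact Real.contDiff_sin
  · have : sinE ε = Real.sinh := by ext; simp [sinE, h]
    rw [this]; exact Real.contDiff_sinh

lemma contDiff_cosE : ContDiff ℝ ∞ (cosE ε) := by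
  by_cases h : ε = 1
  · have : cosE ε = Real.cos := by ext; simp [cosE, h]
    rw [this]; exact Real.contDiff_cos
  · have : cosE ε = Real.cosh := by ext; simp [cosE, h]
    rw [this]; exact Real.contDiff_cosh

lemma sinE_pos {s : ℝ} (h0 : 0 < s) (h1 : ε = 1 → s < Real.pi / 2) : 0 < sinE ε s := by
  unfold sinE
  split_ifs with h
  · exact Real.sin_pos_of_pos_of_lt_pi h0 (by linarith [h1 h, Real.pi_pos])
  · exact Real.sinh_pos_iff.2 h0

lemma cosE_pos {s : ℝ} (h0 : 0 < s) (h1 : ε = 1 → s < Real.pi / 2) : 0 < cosE ε s := by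
  unfold cosE
  split_ifs with h
  · exact Real.cos_pos_of_mem_Ioo ⟨by linarith [Real.pi_pos], h1 h⟩
  · exact Real.cosh_pos s

lemma tanE_eq (s : ℝ) : tanE ε s = sinE ε s / cosE ε s := by
  unfold tanE sinE cosE
  split_ifs
  · exact Real.tan_eq_sin_div_cos s
  · exact Real.tanh_eq_sinh_div_cosh s

end Trig

/-! ### An adapted frame of the ambient space -/

section Frame

variable {n : ℕ} {ε : ℝ}

lemma dotProduct_self_nn (w : Fin n → ℝ) : 0 ≤ w ⬝ᵥ w :=
  Finset.sum_nonneg fun i _ => mul_self_nonneg (w i)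

lemma form_eq (x y : Fin (n + 1) → ℝ) :
    form ε x y = ε * x 0 * y 0 + Fin.tail x ⬝ᵥ Fin.tail y := rfl

lemma form_comm (x y : Fin (n + 1) → ℝ) : form ε x y = form ε y x := by
  rw [form_eq, form_eq, dotProduct_comm]; ring

lemma tail_add (x y : Fin (n + 1) → ℝ) : Fin.tail (x + y) = Fin.tail x + Fin.tail y := rfl

lemma tail_smul (a : ℝ) (x : Fin (n + 1) → ℝ) : Fin.tail (a • x) = a • Fin.tail x := rfl

/-- `form ε · y` as a continuous linear functional. -/
noncomputable def formL (ε : ℝ) (y : Fin (n + 1) → ℝ) : (Fin (n + 1) → ℝ) →L[ℝ] ℝ :=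
  LinearMap.toContinuousLinearMap
    { toFun := fun x => form ε x y
      map_add' := fun x z => by simp [form_eq, tail_add, add_dotProduct]; ring
      map_smul' := fun a x => by simp [form_eq, tail_smul]; ring }

@[simp] lemma formL_apply (x y : Fin (n + 1) → ℝ) : formL ε y x = form ε x y := rfl

lemma form_add_left (x z y : Fin (n + 1) → ℝ) :
    form ε (x + z) y = form ε x y + form ε z y := map_add (formL ε y) x z

lemma form_smul_left (a : ℝ) (x y : Fin (n + 1) → ℝ) :
    form ε (a • x) y = a * form ε x y := map_smul (formL ε y) a x

lemma form_add_right (x z y : Fin (n + 1) → ℝ) :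
    form ε y (x + z) = form ε y x + form ε y z := by
  rw [form_comm, form_add_left, form_comm x, form_comm z]

lemma form_smul_right (a : ℝ) (x y : Fin (n + 1) → ℝ) :
    form ε x (a • y) = a * form ε x y := by
  rw [form_comm, form_smul_left, form_comm y]

/-- The isometric embedding of `ℝⁿ` onto the orthogonal complement of `o`, obtained by applying
to `{0} × ℝⁿ` the rotation (or the boost) that takes `(1, 0)` to `o` in the plane they span.
When `o = (-1, 0)` the quotient is `0 / 0 = 0`, and the map is the standard embedding. -/
noncomputable def frameEmb (ε : ℝ) (o : Fin (n + 1) → ℝ) : (Fin n → ℝ) →L[ℝ] (Fin (n + 1) → ℝ) :=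
  LinearMap.toContinuousLinearMap
    { toFun := fun w => Fin.cons (-ε * (Fin.tail o ⬝ᵥ w))
        (w - (ε * (Fin.tail o ⬝ᵥ w) / (1 + o 0)) • Fin.tail o)
      map_add' := fun w z => by
        ext i
        refine Fin.cases ?_ (fun j => ?_) i
        · simp [dotProduct_add]; ring
        · simp [dotProduct_add]; ring
      map_smul' := fun a w => by
        ext i
        refine Fin.cases ?_ (fun j => ?_) i
        · simp; ring
        · simp; ring }

/-- The coordinates of the component orthogonal to `o`, with respect to `frameEmb ε o`. -/
noncomputable def frameCoord (ε : ℝ) (o : Fin (n + 1) → ℝ) :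
    (Fin (n + 1) → ℝ) →L[ℝ] (Fin n → ℝ) :=
  LinearMap.toContinuousLinearMap
    { toFun := fun x => Fin.tail x -
        (x 0 + ε * (Fin.tail o ⬝ᵥ Fin.tail x) / (1 + o 0)) • Fin.tail o
      map_add' := fun w z => by
        ext j
        simp [tail_add, dotProduct_add]; ring
      map_smul' := fun a w => by
        ext j
        simp [tail_smul]; ring }

lemma frameEmb_apply (o : Fin (n + 1) → ℝ) (w : Fin n → ℝ) :
    frameEmb ε o w = Fin.cons (-ε * (Fin.tail o ⬝ᵥ w))
        (w - (ε * (Fin.tail o ⬝ᵥ w) / (1 + o 0)) • Fin.tail o) := rfl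

lemma frameCoord_apply (o x : Fin (n + 1) → ℝ) :
    frameCoord ε o x = Fin.tail x -
        (x 0 + ε * (Fin.tail o ⬝ᵥ Fin.tail x) / (1 + o 0)) • Fin.tail o := rfl

lemma tail_frameEmb (o : Fin (n + 1) → ℝ) (w : Fin n → ℝ) :
    Fin.tail (frameEmb ε o w) = w - (ε * (Fin.tail o ⬝ᵥ w) / (1 + o 0)) • Fin.tail o := rfl

lemma frameEmb_zero (o : Fin (n + 1) → ℝ) (w : Fin n → ℝ) :
    frameEmb ε o w 0 = -ε * (Fin.tail o ⬝ᵥ w) := rfl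

lemma tail_dotProduct_self {o : Fin (n + 1) → ℝ} (ho : o ∈ spaceForm ε n) :
    Fin.tail o ⬝ᵥ Fin.tail o = ε * (1 - o 0) * (1 + o 0) := by
  have := ho.1
  rw [form_eq] at this
  linear_combination this

lemma tail_eq_zero {o : Fin (n + 1) → ℝ} (ho : o ∈ spaceForm ε n) (h : 1 + o 0 = 0) :
    Fin.tail o = 0 := by
  rw [← dotProduct_self_eq_zero, tail_dotProduct_self ho, h, mul_zero]

lemma form_frameEmb_frameEmb (hε : ε = 1 ∨ ε = -1) {o : Fin (n + 1) → ℝ}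
    (ho : o ∈ spaceForm ε n) (w z : Fin n → ℝ) :
    form ε (frameEmb ε o w) (frameEmb ε o z) = w ⬝ᵥ z := by
  have hε2 : ε ^ 2 = 1 := by rcases hε with rfl | rfl <;> norm_num
  have hb := tail_dotProduct_self ho
  rw [form_eq, frameEmb_zero, frameEmb_zero, tail_frameEmb, tail_frameEmb]
  simp only [sub_dotProduct, dotProduct_sub, smul_dotProduct, dotProduct_smul, smul_eq_mul, hb,
    dotProduct_comm w (Fin.tail o)]
  by_cases h : 1 + o 0 = 0
  · simp [tail_eq_zero ho h]
  · field_simp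
    ring_nf
    simp only [show ε ^ 3 = ε by rw [pow_succ, hε2, one_mul]]
    ring

lemma form_frameEmb_base (hε : ε = 1 ∨ ε = -1) {o : Fin (n + 1) → ℝ}
    (ho : o ∈ spaceForm ε n) (w : Fin n → ℝ) : form ε (frameEmb ε o w) o = 0 := by
  have hε2 : ε ^ 2 = 1 := by rcases hε with rfl | rfl <;> norm_num
  have hb := tail_dotProduct_self ho
  rw [form_eq, frameEmb_zero, tail_frameEmb]
  simp only [sub_dotProduct, smul_dotProduct, smul_eq_mul, hb, dotProduct_comm w (Fin.tail o)]
  by_cases h : 1 + o 0 = 0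
  · simp [tail_eq_zero ho h]
  · field_simp
    ring_nf
    simp only [hε2]
    ring

lemma frame_decomp (hε : ε = 1 ∨ ε = -1) {o : Fin (n + 1) → ℝ}
    (ho : o ∈ spaceForm ε n) (x : Fin (n + 1) → ℝ) :
    (ε * form ε x o) • o + frameEmb ε o (frameCoord ε o x) = x := by
  have hε2 : ε ^ 2 = 1 := by rcases hε with rfl | rfl <;> norm_num
  have hb := tail_dotProduct_self ho
  have key : Fin.tail o ⬝ᵥ frameCoord ε o x =
      (Fin.tail o ⬝ᵥ Fin.tail x) * o 0 - x 0 * (ε * (1 - o 0) * (1 + o 0)) := by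
    rw [frameCoord_apply, dotProduct_sub, dotProduct_smul, hb, smul_eq_mul]
    by_cases h : 1 + o 0 = 0
    · simp [tail_eq_zero ho h, h]
    · field_simp
      linear_combination (-(1 - o 0) * (Fin.tail o ⬝ᵥ Fin.tail x)) * hε2
  ext i
  refine Fin.cases ?_ (fun j => ?_) i
  · rw [Pi.add_apply, frameEmb_zero, key, form_eq, dotProduct_comm (Fin.tail x)]
    simp only [Pi.smul_apply, smul_eq_mul]
    linear_combination (x 0) * hε2
  · rw [Pi.add_apply, frameEmb_apply, Fin.cons_succ, key, form_eq, dotProduct_comm (Fin.tail x)]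
    simp only [frameCoord_apply, Pi.smul_apply, smul_eq_mul, Pi.sub_apply, Fin.tail]
    by_cases h : 1 + o 0 = 0
    · have : o j.succ = 0 := congrFun (tail_eq_zero ho h) j
      simp [this]
    · field_simp
      linear_combination (x 0 * o j.succ * (1 + o 0)) * hε2

lemma frameCoord_frameEmb (hε : ε = 1 ∨ ε = -1) {o : Fin (n + 1) → ℝ}
    (ho : o ∈ spaceForm ε n) (w : Fin n → ℝ) : frameCoord ε o (frameEmb ε o w) = w := by
  have h := frame_decomp hε ho (frameEmb ε o w)
  rw [form_frameEmb_base hε ho, mul_zero, zero_smul, zero_add] at h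
  rw [← sub_eq_zero, ← dotProduct_self_eq_zero, ← form_frameEmb_frameEmb hε ho, map_sub, h,
    sub_self]
  simp [form_eq, Fin.tail_def]

lemma frameCoord_base (hε : ε = 1 ∨ ε = -1) {o : Fin (n + 1) → ℝ}
    (ho : o ∈ spaceForm ε n) : frameCoord ε o o = 0 := by
  have hε2 : ε * ε = 1 := by rcases hε with rfl | rfl <;> norm_num
  have h := frame_decomp hε ho o
  rw [ho.1, hε2, one_smul, add_eq_left] at h
  rw [← frameCoord_frameEmb hε ho (frameCoord ε o o), h, map_zero]

/-- The form in the orthogonal decomposition along `o`. -/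
lemma form_comb (hε : ε = 1 ∨ ε = -1) {o : Fin (n + 1) → ℝ}
    (ho : o ∈ spaceForm ε n) (a b : ℝ) (w z : Fin n → ℝ) :
    form ε (a • o + frameEmb ε o w) (b • o + frameEmb ε o z) = ε * a * b + w ⬝ᵥ z := by
  simp only [form_add_left, form_add_right, form_smul_left, form_smul_right,
    form_frameEmb_base hε ho, form_comm o (frameEmb ε o _), form_frameEmb_frameEmb hε ho, ho.1]
  ring

lemma form_comb_base (hε : ε = 1 ∨ ε = -1) {o : Fin (n + 1) → ℝ}
    (ho : o ∈ spaceForm ε n) (a : ℝ) (w : Fin n → ℝ) :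
    form ε (a • o + frameEmb ε o w) o = ε * a := by
  simp only [form_add_left, form_smul_left, form_frameEmb_base hε ho, ho.1]
  ring

lemma frameCoord_comb (hε : ε = 1 ∨ ε = -1) {o : Fin (n + 1) → ℝ}
    (ho : o ∈ spaceForm ε n) (a : ℝ) (w : Fin n → ℝ) :
    frameCoord ε o (a • o + frameEmb ε o w) = w := by
  rw [map_add, map_smul, frameCoord_base hε ho, frameCoord_frameEmb hε ho, smul_zero, zero_add]

lemma form_self_decomp (hε : ε = 1 ∨ ε = -1) {o : Fin (n + 1) → ℝ}
    (ho : o ∈ spaceForm ε n) (x : Fin (n + 1) → ℝ) :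
    form ε x x = ε * form ε x o ^ 2 + frameCoord ε o x ⬝ᵥ frameCoord ε o x := by
  have hε2 : ε * ε = 1 := by rcases hε with rfl | rfl <;> norm_num
  conv_lhs => rw [← frame_decomp hε ho x, form_comb hε ho]
  linear_combination (ε * form ε x o ^ 2) * hε2

/-- Two unit timelike vectors lie on the same sheet of the hyperboloid iff their product is
negative. -/
lemma zero_lt_iff_form_neg {x o : Fin (n + 1) → ℝ} (ho : form (-1) o o = -1) (ho0 : 0 < o 0)
    (hx : form (-1) x x = -1) : 0 < x 0 ↔ form (-1) x o < 0 := by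
  have hcs : (Fin.tail x ⬝ᵥ Fin.tail o) ^ 2 ≤
      (Fin.tail x ⬝ᵥ Fin.tail x) * (Fin.tail o ⬝ᵥ Fin.tail o) := by
    have := Finset.sum_mul_sq_le_sq_mul_sq Finset.univ (Fin.tail x) (Fin.tail o)
    simpa only [dotProduct, ← pow_two] using this
  rw [form_eq] at ho hx ⊢
  have h1 : Fin.tail x ⬝ᵥ Fin.tail x = x 0 ^ 2 - 1 := by linear_combination hx
  have h2 : Fin.tail o ⬝ᵥ Fin.tail o = o 0 ^ 2 - 1 := by linear_combination ho
  have hx1 : 0 ≤ x 0 ^ 2 - 1 := by rw [← h1]; exact dotProduct_self_nn (Fin.tail x)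
  have ho1 : 0 ≤ o 0 ^ 2 - 1 := by rw [← h2]; exact dotProduct_self_nn (Fin.tail o)
  rw [h1, h2] at hcs
  have hlt : (Fin.tail x ⬝ᵥ Fin.tail o) ^ 2 < (x 0 * o 0) ^ 2 := by nlinarith
  constructor
  · intro hx0
    have := abs_lt_of_sq_lt_sq hlt (by positivity)
    linarith [(abs_lt.1 this).2]
  · intro h
    by_contra hx0
    have h3 : 0 ≤ -(x 0 * o 0) := by nlinarith
    have := abs_lt_of_sq_lt_sq (a := Fin.tail x ⬝ᵥ Fin.tail o) (by rwa [neg_sq]) h3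
    linarith [(abs_lt.1 this).1]

lemma mem_spaceForm_iff (hε : ε = 1 ∨ ε = -1) {o : Fin (n + 1) → ℝ}
    (ho : o ∈ spaceForm ε n) (x : Fin (n + 1) → ℝ) :
    x ∈ spaceForm ε n ↔ form ε x x = ε ∧ (ε = -1 → 0 < ε * form ε x o) := by
  unfold spaceForm
  rw [Set.mem_ofPred_eq]
  refine and_congr_right fun h => forall_congr' fun he => ?_
  subst he
  rw [zero_lt_iff_form_neg ho.1 (ho.2 rfl) h]
  constructor <;> intro <;> linarith

/-- A point of the space form lies at distance `s` from `o` iff its `o`-component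
is `cos_ε s`. -/
lemma geoDist_eq_iff (hε : ε = 1 ∨ ε = -1) {o : Fin (n + 1) → ℝ}
    (ho : o ∈ spaceForm ε n) {x : Fin (n + 1) → ℝ} (hx : x ∈ spaceForm ε n) {s : ℝ} (h0 : 0 ≤ s)
    (h1 : ε = 1 → s ≤ Real.pi) : geoDist ε x o = s ↔ form ε x o = ε * cosE ε s := by
  have hd := form_self_decomp hε ho x
  rw [hx.1] at hd
  have hnn := dotProduct_self_nn (frameCoord ε o x)
  have hm := ((mem_spaceForm_iff hε ho x).1 hx).2
  rcases hε with rfl | rfl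
  · have : |form 1 x o| ≤ 1 := by
      rw [← sq_le_one_iff_abs_le_one]; linarith
    simp only [geoDist, cosE, if_true, one_mul]
    constructor
    · rintro rfl
      rw [Real.cos_arccos (abs_le.1 this).1 (abs_le.1 this).2]
    · intro h
      rw [h, Real.arccos_cos h0 (h1 rfl)]
  · have hm := hm rfl
    have h2 : 1 ≤ -form (-1) x o := by
      by_contra hlt
      nlinarith
    norm_num [geoDist, cosE]
    constructor
    · intro h
      rw [← h, Real.cosh_arcosh h2, neg_neg]
    · intro h
      rw [h, neg_neg, Real.arcosh_cosh h0]

end Frame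

/-! ### Primitives and smooth changes of variable on the line -/

section TimeChange

open Filter Topology

lemma exists_smooth_primitive {w : ℝ → ℝ} (hw : ContDiff ℝ ∞ w) :
    ∃ T : ℝ → ℝ, T 0 = 0 ∧ ContDiff ℝ ∞ T ∧ ∀ x, HasDerivAt T (w x) x := by
  have hd : ∀ x, HasDerivAt (fun x => ∫ y in (0 : ℝ)..x, w y) (w x) x := fun x =>
    intervalIntegral.integral_hasDerivAt_right (hw.continuous.intervalIntegrable _ _)
      (hw.continuous.stronglyMeasurableAtFilter _ _) hw.continuous.continuousAt
  refine ⟨fun x => ∫ y in (0 : ℝ)..x, w y, by simp, ?_, hd⟩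
  rw [contDiff_infty_iff_deriv]
  refine ⟨fun x => (hd x).differentiableAt, ?_⟩
  rwa [funext fun x => (hd x).deriv]

lemma strictMono_of_hasDerivAt_pos {T w : ℝ → ℝ} (hT : ∀ x, HasDerivAt T (w x) x)
    (hw : ∀ x, 0 < w x) : StrictMono T :=
  strictMono_of_deriv_pos fun x => by rw [(hT x).deriv]; exact hw x

lemma exists_smooth_leftInverse {T w : ℝ → ℝ} (hs : ContDiff ℝ ∞ T)
    (hT : ∀ x, HasDerivAt T (w x) x) (hw : ∀ x, 0 < w x) :
    IsOpen (Set.range T) ∧ ∃ g : ℝ → ℝ, (∀ x, g (T x) = x) ∧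
      ∀ x, ContDiffAt ℝ ∞ g (T x) ∧ HasDerivAt g (w x)⁻¹ (T x) := by
  have hmono := strictMono_of_hasDerivAt_pos hT hw
  have hopen : IsOpenMap T := isOpenMap_of_hasStrictDerivAt
    (fun x => hs.contDiffAt.hasStrictDerivAt' (hT x) (by simp)) fun x => (hw x).ne'
  have hemb : IsOpenEmbedding T := .of_continuous_injective_isOpenMap hs.continuous
    hmono.injective hopen
  have hleft : ∀ x, (hemb.toOpenPartialHomeomorph T).symm (T x) = x := fun x => by
    simpa using (hemb.toOpenPartialHomeomorph T).left_inv (x := x) (by simp)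
  refine ⟨hemb.isOpen_range, (hemb.toOpenPartialHomeomorph T).symm, hleft, fun x => ⟨?_, ?_⟩⟩
  · refine (hemb.toOpenPartialHomeomorph T).contDiffAt_symm_deriv (hw x).ne' (by simp) ?_ ?_
    · rw [hleft]; simpa using hT x
    · rw [hleft]; simpa using hs.contDiffAt
  · exact ((hs.contDiffAt.hasStrictDerivAt' (hT x) (by simp)).to_local_left_inverse (hw x).ne'
      (Eventually.of_forall hleft)).hasDerivAt

/-- A primitive `T` of a smooth function bounded below by a positive constant is a
diffeomorphism of the line; `g` is its inverse. -/
structure IsTimeChange (w T g : ℝ → ℝ) : Prop where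
  pos : ∀ x, 0 < w x
  zero : T 0 = 0
  hasDerivAt : ∀ x, HasDerivAt T (w x) x
  left_inv : ∀ x, g (T x) = x
  right_inv : ∀ t, T (g t) = t
  contDiff_inv : ContDiff ℝ ∞ g
  hasDerivAt_inv : ∀ t, HasDerivAt g (w (g t))⁻¹ t

lemma exists_timeChange {w : ℝ → ℝ} (hw : ContDiff ℝ ∞ w) {a : ℝ} (ha : 0 < a)
    (haw : ∀ x, a ≤ w x) : ∃ T g : ℝ → ℝ, IsTimeChange w T g := by
  have hpos : ∀ x, 0 < w x := fun x => ha.trans_le (haw x)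
  obtain ⟨T, hT0, hTs, hT⟩ := exists_smooth_primitive hw
  obtain ⟨-, g, hg, hg'⟩ := exists_smooth_leftInverse hTs hT hpos
  have hmono : Monotone fun x => T x - a * x := by
    have hd : ∀ x, HasDerivAt (fun x => T x - a * x) (w x - a) x := fun x =>
      ((hT x).sub ((hasDerivAt_id x).const_mul a)).congr_deriv (by ring)
    exact monotone_of_deriv_nonneg (fun x => (hd x).differentiableAt) fun x => by
      rw [(hd x).deriv]; linarith [haw x]
  have hsurj : Function.Surjective T := by
    refine hTs.continuous.surjective ?_ ?_
    · refine tendsto_atTop_mono' _ ?_ (tendsto_id.const_mul_atTop ha)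
      filter_upwards [eventually_ge_atTop 0] with x hx
      have := hmono hx
      simp only [hT0, mul_zero, sub_zero] at this
      simp only [id]; linarith
    · refine tendsto_atBot_mono' _ ?_ (tendsto_id.const_mul_atBot ha)
      filter_upwards [eventually_le_atBot 0] with x hx
      have := hmono hx
      simp only [hT0, mul_zero, sub_zero] at this
      simp only [id]; linarith
  have hright : ∀ t, T (g t) = t := fun t => by
    obtain ⟨x, rfl⟩ := hsurj t
    rw [hg]
  refine ⟨T, g, hpos, hT0, hT, hg, hright, contDiff_iff_contDiffAt.2 fun t => ?_, fun t => ?_⟩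
  · rw [← hright t]; exact (hg' _).1
  · conv_lhs => rw [← hright t]
    have := (hg' (g t)).2
    rw [hright t] at this ⊢
    exact this

namespace IsTimeChange

variable {w T g : ℝ → ℝ}

lemma strictMono (h : IsTimeChange w T g) : StrictMono T :=
  strictMono_of_hasDerivAt_pos h.hasDerivAt h.pos

lemma inv_strictMono (h : IsTimeChange w T g) : StrictMono g := fun x y hxy => by
  rw [← h.right_inv x, ← h.right_inv y] at hxy
  exact h.strictMono.lt_iff_lt.1 hxy

lemma inv_zero (h : IsTimeChange w T g) : g 0 = 0 := by
  rw [← h.zero, h.left_inv, h.zero]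

lemma inv_neg (h : IsTimeChange w T g) (hw : ∀ x, w (-x) = w x) (t : ℝ) : g (-t) = -g t := by
  have hd : ∀ x, HasDerivAt (fun x => T x + T (-x)) 0 x := fun x => by
    have h2 : HasDerivAt (fun x => T (-x)) (w (-x) * (-1)) x :=
      (h.hasDerivAt (-x)).comp x (hasDerivAt_neg x)
    have := (h.hasDerivAt x).add h2
    rw [hw] at this
    exact this.congr_deriv (by ring)
  have hc := is_const_of_deriv_eq_zero (fun x => (hd x).differentiableAt)
    (fun x => (hd x).deriv) (g t) 0
  simp only [neg_zero, h.zero, add_zero, h.right_inv] at hc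
  rw [← h.left_inv (-g t)]
  congr 1; linarith

lemma inv_add_period (h : IsTimeChange w T g) {p : ℝ} (hw : ∀ x, w (x + p) = w x) (t : ℝ) :
    g (t + T p) = g t + p := by
  have hd : ∀ x, HasDerivAt (fun x => T (x + p) - T x) 0 x := fun x => by
    have h2 : HasDerivAt (fun x => T (x + p)) (w (x + p) * 1) x :=
      (h.hasDerivAt (x + p)).comp x ((hasDerivAt_id x).add_const p)
    have := h2.sub (h.hasDerivAt x)
    rw [hw] at this
    exact this.congr_deriv (by ring)
  have hc := is_const_of_deriv_eq_zero (fun x => (hd x).differentiableAt)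
    (fun x => (hd x).deriv) (g t) 0
  simp only [zero_add, h.zero, sub_zero, h.right_inv] at hc
  rw [← h.left_inv (g t + p)]
  congr 1; linarith

end IsTimeChange

end TimeChange

/-! ### Profile curves by quadrature -/

section Profile

open Filter Topology

/-- The inverse of `sin_ε` on the range of radii `(0, π / 2)` or `(0, ∞)`. -/
noncomputable def arcsinE (ε y : ℝ) : ℝ := if ε = 1 then Real.arcsin y else Real.arsinh y

variable {ε : ℝ}

lemma sinE_arcsinE {y : ℝ} (h0 : 0 ≤ y) (h1 : ε = 1 → y < 1) : sinE ε (arcsinE ε y) = y := by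
  unfold sinE arcsinE
  split_ifs with h
  · exact Real.sin_arcsin (by linarith) (h1 h).le
  · exact Real.sinh_arsinh y

lemma arcsinE_sinE {s : ℝ} (h0 : 0 ≤ s) (h1 : ε = 1 → s < Real.pi / 2) :
    arcsinE ε (sinE ε s) = s := by
  unfold sinE arcsinE
  split_ifs with h
  · exact Real.arcsin_sin (by linarith [Real.pi_pos]) (h1 h).le
  · exact Real.arsinh_sinh s

lemma arcsinE_lt_arcsinE {x y : ℝ} (h0 : 0 ≤ x) (hxy : x < y) (h1 : ε = 1 → y < 1) :
    arcsinE ε x < arcsinE ε y := by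
  unfold arcsinE
  split_ifs with h
  · exact Real.strictMonoOn_arcsin ⟨by linarith, by linarith [h1 h]⟩
      ⟨by linarith, (h1 h).le⟩ hxy
  · exact Real.arsinh_lt_arsinh.2 hxy

lemma arcsinE_lt_pi_div_two {y : ℝ} (h1 : y < 1) : arcsinE 1 y < Real.pi / 2 := by
  simpa [arcsinE] using Real.arcsin_lt_pi_div_two.2 h1

lemma contDiffAt_arcsinE {y : ℝ} (h0 : 0 ≤ y) (h1 : ε = 1 → y < 1) :
    ContDiffAt ℝ ∞ (arcsinE ε) y := by
  by_cases h : ε = 1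
  · have : arcsinE ε = Real.arcsin := by ext; simp [arcsinE, h]
    rw [this]
    exact Real.contDiffAt_arcsin (by linarith) (h1 h).ne
  · have : arcsinE ε = Real.arsinh := by ext; simp [arcsinE, h]
    rw [this]
    exact Real.contDiff_arsinh.contDiffAt

/-- The distance to the axis, as a function of the height, of a rotational hypersurface whose
scalar curvature is `n (n - 1) (C + ε)`. -/
structure IsCSCProfile (ε : ℝ) (n : ℕ) (C : ℝ) (r : ℝ → ℝ) : Prop where
  smooth : ContDiff ℝ ∞ r
  pos : ∀ t, 0 < r t
  lt_pi_div_two : ε = 1 → ∀ t, r t < Real.pi / 2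
  ode : ∀ t, 2 * deriv (deriv r) t * (sinE ε (r t) * cosE ε (r t)) =
    (((n : ℝ) - 2) * cosE ε (r t) ^ 2 - 2 * ε * sinE ε (r t) ^ 2) * (1 + deriv r t ^ 2)
      - n * C * sinE ε (r t) ^ 2 * (1 + deriv r t ^ 2) ^ 2

/-- The first integral `(1 + r'²) (C sin_εⁿ r + G₀) = sin_εⁿ⁻² r cos_ε² r` implies the profile
equation as soon as the zeros of `r'` have no interior. -/
lemma profile_ode_of_first_integral (hε : ε = 1 ∨ ε = -1) {m : ℕ} {C G₀ : ℝ} {r : ℝ → ℝ}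
    (hr : ContDiff ℝ ∞ r) (hs : ∀ t, 0 < sinE ε (r t)) (hc : ∀ t, 0 < cosE ε (r t))
    (h1 : ∀ t, (1 + deriv r t ^ 2) * (C * sinE ε (r t) ^ (m + 3) + G₀) =
      sinE ε (r t) ^ (m + 1) * cosE ε (r t) ^ 2)
    (h2 : ∀ t, ¬ ∀ᶠ x in 𝓝 t, deriv r x = 0) (t : ℝ) :
    2 * deriv (deriv r) t * (sinE ε (r t) * cosE ε (r t)) =
    ((((m + 3 : ℕ) : ℝ) - 2) * cosE ε (r t) ^ 2 - 2 * ε * sinE ε (r t) ^ 2) * (1 + deriv r t ^ 2)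
      - ((m + 3 : ℕ) : ℝ) * C * sinE ε (r t) ^ 2 * (1 + deriv r t ^ 2) ^ 2 := by
  have hr1 : ContDiff ℝ ∞ (deriv r) := (contDiff_infty_iff_deriv.1 hr).2
  have hr2 : ContDiff ℝ ∞ (deriv (deriv r)) := (contDiff_infty_iff_deriv.1 hr1).2
  have d0 : ∀ t, HasDerivAt r (deriv r t) t := fun t =>
    (hr.differentiable (by simp) t).hasDerivAt
  have d1 : ∀ t, HasDerivAt (deriv r) (deriv (deriv r) t) t := fun t =>
    (hr1.differentiable (by simp) t).hasDerivAt
  have ds : ∀ t, HasDerivAt (fun t => sinE ε (r t)) (cosE ε (r t) * deriv r t) t := fun t =>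
    (hasDerivAt_sinE (r t)).comp t (d0 t)
  have dc : ∀ t, HasDerivAt (fun t => cosE ε (r t)) (-ε * sinE ε (r t) * deriv r t) t := fun t =>
    (hasDerivAt_cosE hε (r t)).comp t (d0 t)
  have cs : Continuous fun t => sinE ε (r t) := contDiff_sinE.continuous.comp hr.continuous
  have cc : Continuous fun t => cosE ε (r t) := contDiff_cosE.continuous.comp hr.continuous
  -- the derivative of the first integral is `r' * E`
  set E : ℝ → ℝ := fun t => 2 * deriv (deriv r) t * (C * sinE ε (r t) ^ (m + 3) + G₀)
    + (1 + deriv r t ^ 2) * (C * ((m + 3) * sinE ε (r t) ^ (m + 2) * cosE ε (r t)))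
    - (m + 1) * sinE ε (r t) ^ m * cosE ε (r t) ^ 3
    + 2 * ε * sinE ε (r t) ^ (m + 2) * cosE ε (r t) with hE
  have cE : Continuous E := by
    have := hr1.continuous
    have := hr2.continuous
    fun_prop
  have hprod : ∀ t, deriv r t * E t = 0 := fun t => by
    have hA := (((d1 t).pow 2).const_add 1).mul ((((ds t).pow (m + 3)).const_mul C).add_const G₀)
    have hB := ((ds t).pow (m + 1)).mul ((dc t).pow 2)
    have hAB := hA.sub hB
    have hz : HasDerivAt (fun _ : ℝ => (0 : ℝ)) 0 t := hasDerivAt_const t 0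
    have hEq := (hAB.congr_of_eventuallyEq (f₁ := fun _ => 0)
      (Eventually.of_forall fun x => by simp [h1 x])).unique hz
    rw [← hEq, hE]
    simp
    ring
  have hE0 : E t = 0 := by
    by_contra hne
    refine h2 t ?_
    filter_upwards [cE.continuousAt.eventually_ne hne] with x hx
    exact (mul_eq_zero.1 (hprod x)).resolve_right hx
  have hne : sinE ε (r t) ^ m * cosE ε (r t) ≠ 0 :=
    mul_ne_zero (pow_ne_zero _ (hs t).ne') (hc t).ne'
  refine mul_left_cancel₀ hne ?_
  have h1t := h1 t
  simp only [hE] at hE0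
  push_cast
  linear_combination (1 + deriv r t ^ 2) * hE0 - 2 * deriv (deriv r) t * h1t

/-- Construction of a profile from a parametrization `θ ↦ Y θ` of the values of `sin_ε r`,
where `w = dt / dθ`. The variable `θ` resolves the square root singularities of
`dt / dr` at the extrema of `r`. -/
lemma exists_profile_of_quadrature (hε : ε = 1 ∨ ε = -1) {m : ℕ} {C l : ℝ} (hl : 0 < l)
    (hl1 : ε = 1 → l < Real.pi / 2) {Y w T g : ℝ → ℝ} (hY : ContDiff ℝ ∞ Y)
    (hT : IsTimeChange w T g) (hw : ∀ x, w (-x) = w x) (hYe : ∀ x, Y (-x) = Y x)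
    (hY0 : Y 0 = sinE ε l) (hYl : ∀ x, sinE ε l ≤ Y x) (hY1 : ε = 1 → ∀ x, Y x < 1) {G₀ : ℝ}
    (h1 : ∀ x, deriv Y x ^ 2 * (C * Y x ^ (m + 3) + G₀) =
      w x ^ 2 * (1 - ε * Y x ^ 2) * (Y x ^ (m + 1) - (C + ε) * Y x ^ (m + 3) - G₀))
    (h2 : ∀ x, deriv Y x = 0 → deriv (deriv Y) x ≠ 0) :
    IsCSCProfile ε (m + 3) C (fun t => arcsinE ε (Y (g t))) ∧
      arcsinE ε (Y (g 0)) = l ∧ (∀ t, l ≤ arcsinE ε (Y (g t))) ∧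
      ∀ t, arcsinE ε (Y (g (-t))) = arcsinE ε (Y (g t)) := by
  have hy0 : 0 < sinE ε l := sinE_pos hl hl1
  have hYpos : ∀ x, 0 < Y x := fun x => hy0.trans_le (hYl x)
  have hY1' : ∀ x, ε = 1 → Y x < 1 := fun x h => hY1 h x
  set r : ℝ → ℝ := fun t => arcsinE ε (Y (g t)) with hrdef
  have hr : ContDiff ℝ ∞ r := contDiff_iff_contDiffAt.2 fun t =>
    ContDiffAt.comp (g := arcsinE ε) t (contDiffAt_arcsinE (hYpos (g t)).le (hY1' _))
      (hY.comp hT.contDiff_inv).contDiffAt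
  have hlr : ∀ t, l ≤ r t := fun t => by
    rcases (hYl (g t)).eq_or_lt with h | h
    · simp only [hrdef]; rw [← h, arcsinE_sinE hl.le hl1]
    · simp only [hrdef]
      conv_lhs => rw [← arcsinE_sinE hl.le hl1]
      exact (arcsinE_lt_arcsinE hy0.le h (hY1' _)).le
  have hpos : ∀ t, 0 < r t := fun t => hl.trans_le (hlr t)
  have hlt : ε = 1 → ∀ t, r t < Real.pi / 2 := fun h t => by
    simp only [hrdef]; subst h; exact arcsinE_lt_pi_div_two (hY1 rfl _)
  have hsin : ∀ t, sinE ε (r t) = Y (g t) := fun t =>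
    sinE_arcsinE (hYpos (g t)).le (hY1' _)
  have hc : ∀ t, 0 < cosE ε (r t) := fun t => cosE_pos (hpos t) fun h => hlt h t
  have dY : ∀ x, HasDerivAt Y (deriv Y x) x := fun x =>
    (hY.differentiable (by simp) x).hasDerivAt
  have hY' : ContDiff ℝ ∞ (deriv Y) := (contDiff_infty_iff_deriv.1 hY).2
  have dY' : ∀ x, HasDerivAt (deriv Y) (deriv (deriv Y) x) x := fun x =>
    (hY'.differentiable (by simp) x).hasDerivAt
  have hr' : ∀ t, cosE ε (r t) * deriv r t = deriv Y (g t) * (w (g t))⁻¹ := fun t => by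
    have hA : HasDerivAt (fun t => sinE ε (r t)) (cosE ε (r t) * deriv r t) t :=
      (hasDerivAt_sinE (r t)).comp t (hr.differentiable (by simp) t).hasDerivAt
    have hB : HasDerivAt (fun t => Y (g t)) (deriv Y (g t) * (w (g t))⁻¹) t :=
      (dY (g t)).comp t (hT.hasDerivAt_inv t)
    rw [funext hsin] at hA
    exact hA.unique hB
  refine ⟨⟨hr, hpos, hlt, profile_ode_of_first_integral (G₀ := G₀) hε hr
    (fun t => by rw [hsin]; exact hYpos _) hc (fun t => ?_) fun t ht => ?_⟩, ?_, hlr, fun t => ?_⟩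
  · have hw0 := (hT.pos (g t)).ne'
    have hcs := cosE_sq_add hε (r t)
    have h := h1 (g t)
    have hd : deriv Y (g t) = cosE ε (r t) * deriv r t * w (g t) := by
      rw [hr']; field_simp
    rw [hd, ← hsin t] at h
    have hne : w (g t) ^ 2 * cosE ε (r t) ^ 2 ≠ 0 :=
      mul_ne_zero (pow_ne_zero _ hw0) (pow_ne_zero _ (hc t).ne')
    refine mul_left_cancel₀ hne ?_
    rw [show 1 - ε * sinE ε (r t) ^ 2 = cosE ε (r t) ^ 2 by linarith] at h
    linear_combination h + (w (g t) ^ 2 * cosE ε (r t) ^ 2 * sinE ε (r t) ^ (m + 1)) * (-hcs)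
  -- if `r'` vanished near `t`, so would `Y' ∘ g`, hence also `Y''` at `g t`
  · have hev : ∀ᶠ x in 𝓝 t, deriv Y (g x) = 0 := by
      filter_upwards [ht] with x hx
      have := hr' x
      rw [hx, mul_zero, eq_comm, mul_eq_zero] at this
      exact this.resolve_right (inv_ne_zero (hT.pos _).ne')
    have hD : HasDerivAt (fun t => deriv Y (g t)) (deriv (deriv Y) (g t) * (w (g t))⁻¹) t :=
      (dY' (g t)).comp t (hT.hasDerivAt_inv t)
    have := (hD.congr_of_eventuallyEq (f₁ := fun _ => 0) (hev.mono fun x hx => hx.symm)).unique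
      (hasDerivAt_const t 0)
    rw [mul_eq_zero] at this
    exact h2 _ hev.self_of_nhds (this.resolve_right (inv_ne_zero (hT.pos _).ne'))
  · rw [hT.inv_zero, hY0, arcsinE_sinE hl.le hl1]
  · rw [hT.inv_neg hw, hYe]

end Profile

/-! ### Existence of the profiles -/

section ProfileExistence

variable {ε : ℝ}

/-- The second positive root of `G - G₀`, where `G y = yᵏ (1 - K y²)` and `G₀ = G y₀` with `y₀`
to the left of the maximum of `G`, and the quotient `Q` of `G - G₀` by its two simple factors. -/
lemma exists_second_root {m : ℕ} {K y₀ : ℝ} (hK : 0 < K) (hy₀ : 0 < y₀)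
    (h : (m + 3) * K * y₀ ^ 2 < m + 1) :
    ∃ (y₁ : ℝ) (Q : ℝ → ℝ), y₀ < y₁ ∧ K * y₁ ^ 2 < 1 ∧ ContDiff ℝ ∞ Q ∧
      (∀ y, y ^ (m + 1) - K * y ^ (m + 3) - (y₀ ^ (m + 1) - K * y₀ ^ (m + 3)) =
        (y - y₀) * (y₁ - y) * Q y) ∧ ∀ y, y₀ ≤ y → y ≤ y₁ → 0 < Q y := by
  have hm : (0 : ℝ) ≤ m := Nat.cast_nonneg m
  set G : ℝ → ℝ := fun y => y ^ (m + 1) - K * y ^ (m + 3) with hG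
  have dG : ∀ y, HasDerivAt G (y ^ m * (m + 1 - (m + 3) * K * y ^ 2)) y := fun y =>
    ((hasDerivAt_pow (m + 1) y).sub ((hasDerivAt_pow (m + 3) y).const_mul K)).congr_deriv (by
      rw [show m + 1 - 1 = m from rfl, show m + 3 - 1 = m + 2 from rfl]; push_cast; ring)
  have cG : Continuous G := by fun_prop
  obtain ⟨z, hz, hzK⟩ : ∃ z : ℝ, 0 < z ∧ (m + 3) * K * z ^ 2 = m + 1 := by
    refine ⟨√((m + 1) / ((m + 3) * K)), Real.sqrt_pos.2 (by positivity), ?_⟩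
    rw [Real.sq_sqrt (by positivity)]; field_simp
  obtain ⟨b, hb, hbK⟩ : ∃ b : ℝ, 0 < b ∧ K * b ^ 2 = 1 := by
    refine ⟨√(1 / K), Real.sqrt_pos.2 (by positivity), ?_⟩
    rw [Real.sq_sqrt (by positivity)]; field_simp
  have hy₀z : y₀ < z := by
    refine lt_of_pow_lt_pow_left₀ 2 hz.le ?_
    rw [← hzK] at h
    exact lt_of_mul_lt_mul_left h (by positivity)
  have hzb : z < b := by
    refine lt_of_pow_lt_pow_left₀ 2 hb.le (lt_of_mul_lt_mul_left (a := (m + 3) * K) ?_ ?_)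
    · rw [hzK, mul_assoc, hbK]; linarith
    · positivity
  have hinc : StrictMonoOn G (Set.Icc 0 z) := by
    refine strictMonoOn_of_deriv_pos (convex_Icc 0 z) cG.continuousOn fun y hy => ?_
    rw [interior_Icc] at hy
    rw [(dG y).deriv]
    have hy0 := hy.1
    have : y ^ 2 < z ^ 2 := pow_lt_pow_left₀ hy.2 hy0.le (by norm_num)
    have h3 : 0 < (m + 3) * K := by positivity
    have : (m + 3) * K * y ^ 2 < (m + 3) * K * z ^ 2 := mul_lt_mul_of_pos_left this h3
    exact mul_pos (pow_pos hy0 _) (by linarith)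
  -- `z` is the point where `G` is maximal and `b` its positive zero
  have hneg : ∀ y, z < y → y ^ m * (m + 1 - (m + 3) * K * y ^ 2) < 0 := fun y hy => by
    have : z ^ 2 < y ^ 2 := pow_lt_pow_left₀ hy hz.le (by norm_num)
    have h3 : 0 < (m + 3) * K := by positivity
    have : (m + 3) * K * z ^ 2 < (m + 3) * K * y ^ 2 := mul_lt_mul_of_pos_left this h3
    exact mul_neg_of_pos_of_neg (pow_pos (hz.trans hy) _) (by linarith)
  have hdec : StrictAntiOn G (Set.Ici z) := by
    refine strictAntiOn_of_deriv_neg (convex_Ici z) cG.continuousOn fun y hy => ?_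
    rw [interior_Ici] at hy
    rw [(dG y).deriv]
    exact hneg y hy
  have hG₀ : 0 < G y₀ := by
    have := hinc ⟨le_rfl, hz.le⟩ ⟨hy₀.le, hy₀z.le⟩ hy₀
    simpa [hG] using this
  have hGb : G b = 0 := by
    simp only [hG]; linear_combination (-b ^ (m + 1)) * hbK
  have hGz : G y₀ < G z := hinc ⟨hy₀.le, hy₀z.le⟩ ⟨hz.le, le_rfl⟩ hy₀z
  obtain ⟨y₁, ⟨hzy₁, hy₁b⟩, hGy₁⟩ : ∃ y₁ ∈ Set.Ioo z b, G y₁ = G y₀ :=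
    intermediate_value_Ioo' hzb.le cG.continuousOn ⟨by rwa [hGb], hGz⟩
  have h01 : y₀ < y₁ := hy₀z.trans hzy₁
  obtain ⟨R, hR⟩ : ∃ R : Polynomial ℝ, ∀ y, G y - G y₀ = (y - y₀) * ((y - y₁) * R.eval y) := by
    open Polynomial in
    obtain ⟨R₁, hR₁⟩ : (X - C y₀) ∣
        (X ^ (m + 1) - C K * X ^ (m + 3) - C (G y₀) : Polynomial ℝ) := by
      rw [dvd_iff_isRoot]; simp [hG]
    have hev : ∀ y, G y - G y₀ = (y - y₀) * R₁.eval y := fun y => by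
      have := congrArg (eval y) hR₁
      simpa [hG] using this
    obtain ⟨R, hR⟩ : (X - C y₁) ∣ R₁ := by
      rw [dvd_iff_isRoot]
      have := hev y₁
      rw [hGy₁, sub_self, eq_comm, mul_eq_zero] at this
      exact this.resolve_left (sub_ne_zero.2 h01.ne')
    refine ⟨R, fun y => ?_⟩
    rw [hev, hR]; simp
  have dR : ∀ y, HasDerivAt G (((y - y₁) * R.eval y) + (y - y₀) * (R.eval y + (y - y₁) *
      R.derivative.eval y)) y := fun y => by
    have := (((hasDerivAt_id y).sub_const y₀).mul
      (((hasDerivAt_id y).sub_const y₁).mul (R.hasDerivAt y))).add_const (G y₀)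
    simp only [id, one_mul] at this
    refine this.congr_of_eventuallyEq (Filter.Eventually.of_forall fun x => ?_)
    simp only [Pi.mul_apply, ← hR]; simp
  refine ⟨y₁, fun y => -R.eval y, h01, ?_, (by simpa using (R.contDiff_aeval (𝕜 := ℝ) ∞).neg),
    fun y => ?_, fun y hy hy' => ?_⟩
  · rw [← hbK]
    exact mul_lt_mul_of_pos_left (pow_lt_pow_left₀ hy₁b (hz.trans hzy₁).le (by norm_num)) hK
  · have := hR y
    simp only [hG] at this
    rw [this]; ring
  -- at the two roots `Q` is positive since `G'` does not vanish there
  rcases hy.eq_or_lt with rfl | hy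
  · have h1 := (dG y₀).unique (dR y₀)
    have h2 : 0 < y₀ ^ m * (m + 1 - (m + 3) * K * y₀ ^ 2) :=
      mul_pos (pow_pos hy₀ _) (by linarith)
    rw [h1] at h2
    by_contra hcon
    nlinarith
  rcases hy'.eq_or_lt with rfl | hy'
  · have h1 := (dG y).unique (dR y)
    have h2 := hneg y hzy₁
    rw [h1] at h2
    by_contra hcon
    nlinarith
  have hlt : G y₀ < G y := by
    rcases le_total y z with hyz | hyz
    · exact hinc ⟨hy₀.le, hy₀z.le⟩ ⟨hy₀.le.trans hy.le, hyz⟩ hy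
    · rw [← hGy₁]; exact hdec hyz hzy₁.le hy'
  have h3 : 0 < (y - y₀) * ((y - y₁) * R.eval y) := by rw [← hR]; linarith
  have h4 : 0 < (y - y₁) * R.eval y := pos_of_mul_pos_right h3 (by linarith)
  by_contra hcon
  nlinarith

/-- For `K = C + ε > 0` the values of `sin_ε r` oscillate between the two roots `y₀`, `y₁` of
`G - G₀`. -/
lemma exists_periodic_profile (hε : ε = 1 ∨ ε = -1) {m : ℕ} {C l : ℝ} (hC : 0 < C)
    (hK : 0 < C + ε) (hl : 0 < l) (hl1 : ε = 1 → l < Real.pi / 2)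
    (h : (m + 3) * (C + ε) * sinE ε l ^ 2 < m + 1) :
    ∃ r : ℝ → ℝ, IsCSCProfile ε (m + 3) C r ∧ r 0 = l ∧ (∀ t, l ≤ r t) ∧ (∀ t, r (-t) = r t) ∧
      ∃ h : ℝ, 0 < h ∧ (∀ t, r (t + 2 * h) = r t) ∧ StrictMonoOn r (Set.Icc 0 h) := by
  have hy₀ : 0 < sinE ε l := sinE_pos hl hl1
  set y₀ := sinE ε l with hy₀def
  obtain ⟨y₁, Q, h01, hy₁K, hQs, hQ, hQpos⟩ := exists_second_root hK hy₀ h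
  set G₀ := y₀ ^ (m + 1) - (C + ε) * y₀ ^ (m + 3) with hG₀
  have hy₁1 : ε = 1 → y₁ < 1 := by
    rintro rfl
    by_contra hcon
    nlinarith
  -- `Y' ^ 2 = (Y - y₀) * (y₁ - Y)` cancels the two simple zeros of `G - G₀` in `dt / dθ`
  set M := (y₀ + y₁) / 2 with hM
  set a := (y₁ - y₀) / 2 with ha
  have ha0 : 0 < a := by rw [ha]; linarith
  set Y : ℝ → ℝ := fun x => M - a * Real.cos x with hYdef
  have hYl : ∀ x, y₀ ≤ Y x := fun x => by
    have := mul_le_mul_of_nonneg_left (Real.cos_le_one x) ha0.le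
    simp only [hYdef]; linarith
  have hYu : ∀ x, Y x ≤ y₁ := fun x => by
    have := mul_le_mul_of_nonneg_left (Real.neg_one_le_cos x) ha0.le
    simp only [hYdef]; linarith
  have hYs : ContDiff ℝ ∞ Y := contDiff_const.sub (contDiff_const.mul Real.contDiff_cos)
  have dY : ∀ x, HasDerivAt Y (a * Real.sin x) x := fun x =>
    (((Real.hasDerivAt_cos x).const_mul a).const_sub M).congr_deriv (by ring)
  have dY' : ∀ x, HasDerivAt (deriv Y) (a * Real.cos x) x := fun x => by
    rw [funext fun x => (dY x).deriv]
    exact (Real.hasDerivAt_sin x).const_mul a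
  have hY1 : ε = 1 → ∀ x, Y x < 1 := fun h x => (hYu x).trans_lt (hy₁1 h)
  have hYpos : ∀ x, 0 < Y x := fun x => hy₀.trans_le (hYl x)
  have hG₀pos : 0 < G₀ := by
    have h1 : (C + ε) * y₀ ^ 2 < 1 := lt_of_le_of_lt
      (mul_le_mul_of_nonneg_left (pow_le_pow_left₀ hy₀.le h01.le 2) hK.le) hy₁K
    have h2 := mul_lt_mul_of_pos_left h1 (pow_pos hy₀ (m + 1))
    rw [hG₀]
    linarith [show y₀ ^ (m + 1) * ((C + ε) * y₀ ^ 2) = (C + ε) * y₀ ^ (m + 3) by ring]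
  have hD : ∀ x, 0 < C * Y x ^ (m + 3) + G₀ := fun x => by
    have := pow_pos (hYpos x) (m + 3)
    positivity
  have hcos : ∀ x, 0 < 1 - ε * Y x ^ 2 := fun x => by
    have := hYpos x
    rcases hε with rfl | rfl
    · have := hY1 rfl x; nlinarith
    · nlinarith
  have hq : ∀ x, 0 < Q (Y x) := fun x => hQpos _ (hYl x) (hYu x)
  set w : ℝ → ℝ := fun x => √((C * Y x ^ (m + 3) + G₀) / ((1 - ε * Y x ^ 2) * Q (Y x))) with hwdef
  have hrad : ∀ x, 0 < (C * Y x ^ (m + 3) + G₀) / ((1 - ε * Y x ^ 2) * Q (Y x)) := fun x =>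
    div_pos (hD x) (mul_pos (hcos x) (hq x))
  have hws : ContDiff ℝ ∞ w := by
    refine ContDiff.sqrt ?_ fun x => (hrad x).ne'
    refine ContDiff.div ?_ ?_ fun x => (mul_pos (hcos x) (hq x)).ne'
    · exact (contDiff_const.mul (hYs.pow _)).add contDiff_const
    · exact (contDiff_const.sub (contDiff_const.mul (hYs.pow _))).mul (hQs.comp hYs)
  have hwpos : ∀ x, 0 < w x := fun x => Real.sqrt_pos.2 (hrad x)
  have hYper : ∀ x, Y (x + 2 * Real.pi) = Y x := fun x => by simp [hYdef]
  have hYneg : ∀ x, Y (-x) = Y x := fun x => by simp [hYdef]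
  have hwper : Function.Periodic w (2 * Real.pi) := fun x => by simp only [hwdef, hYper]
  have hwneg : ∀ x, w (-x) = w x := fun x => by simp only [hwdef, hYneg]
  obtain ⟨_, ⟨x₀, rfl⟩, hmin⟩ := (hwper.compact_of_continuous Real.two_pi_pos.ne'
    hws.continuous).exists_isLeast (Set.range_nonempty w)
  obtain ⟨T, g, hT⟩ := exists_timeChange hws (hwpos x₀) fun x => hmin ⟨x, rfl⟩
  obtain ⟨hprof, hr0, hrl, hre⟩ := exists_profile_of_quadrature (C := C) (m := m) (G₀ := G₀)
    hε hl hl1 hYs hT hwneg hYneg (by simp only [hYdef, Real.cos_zero, hM, ha]; ring) hYl hY1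
    (fun x => by
      have hc := (hcos x).ne'
      have hq' := (hq x).ne'
      rw [(dY x).deriv, hwdef]
      simp only
      rw [Real.sq_sqrt (hrad x).le, hQ (Y x)]
      field_simp
      have h1 := Real.sin_sq_add_cos_sq x
      have h2 : (Y x - y₀) * (y₁ - Y x) = a ^ 2 * Real.sin x ^ 2 := by
        simp only [hYdef]
        have e1 : y₀ = M - a := by rw [hM, ha]; ring
        have e2 : y₁ = M + a := by rw [hM, ha]; ring
        rw [e1, e2]
        linear_combination (-a ^ 2) * h1
      linear_combination (-(C * Y x ^ (m + 3) + G₀)) * h2)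
    (fun x hx => by
      rw [(dY x).deriv] at hx
      rw [(dY' x).deriv]
      have hs : Real.sin x = 0 := (mul_eq_zero.1 hx).resolve_left ha0.ne'
      have h1 := Real.sin_sq_add_cos_sq x
      refine mul_ne_zero ha0.ne' fun hcx => ?_
      rw [hs, hcx] at h1; norm_num at h1)
  have hTpi : 0 < T Real.pi := by
    rw [← hT.zero]; exact hT.strictMono Real.pi_pos
  have hT2 : T (2 * Real.pi) = 2 * T Real.pi := by
    have h1 := hT.inv_add_period hwper (-T Real.pi)
    rw [hT.inv_neg hwneg, hT.left_inv] at h1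
    have h2 := congrArg T h1
    rw [hT.right_inv, show -Real.pi + 2 * Real.pi = Real.pi by ring] at h2
    linarith
  refine ⟨_, hprof, hr0, hrl, hre, T Real.pi, hTpi, fun t => ?_, fun t ht t' ht' htt' => ?_⟩
  · simp only [← hT2, hT.inv_add_period hwper, hYper]
  · refine arcsinE_lt_arcsinE (hYpos _).le ?_ fun h => hY1 h _
    have hg : ∀ s ∈ Set.Icc 0 (T Real.pi), g s ∈ Set.Icc 0 Real.pi := fun s hs => by
      rw [← hT.inv_zero, ← hT.left_inv Real.pi]
      exact ⟨hT.inv_strictMono.monotone hs.1, hT.inv_strictMono.monotone hs.2⟩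
    have := Real.strictAntiOn_cos (hg t ht) (hg t' ht') (hT.inv_strictMono htt')
    simp only [hYdef]
    nlinarith

lemma sum_pow_mul_pow_le {x y : ℝ} (hx : 0 < x) (hxy : x ≤ y) (j : ℕ) :
    ∑ i ∈ Finset.range (j + 1), y ^ i * x ^ (j + 1 - 1 - i) ≤ (j + 1) * y ^ j := by
  have hle : ∀ i ∈ Finset.range (j + 1), y ^ i * x ^ (j + 1 - 1 - i) ≤ y ^ j := fun i hi => by
    have hij : i ≤ j := Nat.lt_succ_iff.1 (Finset.mem_range.1 hi)
    calc y ^ i * x ^ (j + 1 - 1 - i) ≤ y ^ i * y ^ (j + 1 - 1 - i) := by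
          have := hx.trans_le hxy
          gcongr
      _ = y ^ j := by rw [← pow_add]; congr 1; omega
  simpa using Finset.sum_le_card_nsmul _ _ _ hle

/-- For `K = C + ε ≤ 0`, hence `ε = -1` and `C ≤ 1`, the profile is defined on the whole line
because `dt / dθ` stays bounded below. -/
lemma exists_unbounded_profile {m : ℕ} {C l : ℝ} (hC : 0 < C) (hC1 : C ≤ 1) (hl : 0 < l) :
    ∃ r : ℝ → ℝ, IsCSCProfile (-1) (m + 3) C r ∧ r 0 = l ∧ (∀ t, l ≤ r t) ∧
      ∀ t, r (-t) = r t := by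
  have h1ne : ¬ ((-1 : ℝ) = 1) := by norm_num
  have hy₀ : 0 < sinE (-1) l := sinE_pos hl fun h => absurd h h1ne
  set y₀ := sinE (-1) l with hy₀def
  set A : ℕ → ℝ → ℝ := fun j y =>
    ∑ i ∈ Finset.range (j + 1), y ^ i * y₀ ^ (j + 1 - 1 - i) with hA
  have hAs : ∀ j, ContDiff ℝ ∞ (A j) := fun j =>
    ContDiff.sum fun i _ => (contDiff_id.pow i).mul contDiff_const
  have hApos : ∀ j y, y₀ ≤ y → 0 < A j y := fun j y hy => by
    have := hy₀.trans_le hy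
    exact Finset.sum_pos (fun i _ => by positivity) ⟨0, by simp⟩
  set Q : ℝ → ℝ := fun y => A m y + (1 - C) * A (m + 2) y with hQdef
  have hQs : ContDiff ℝ ∞ Q := (hAs m).add (contDiff_const.mul (hAs (m + 2)))
  have hQpos : ∀ y, y₀ ≤ y → 0 < Q y := fun y hy =>
    add_pos_of_pos_of_nonneg (hApos m y hy) (mul_nonneg (by linarith) (hApos _ y hy).le)
  set G₀ := y₀ ^ (m + 1) - (C + -1) * y₀ ^ (m + 3) with hG₀
  have hQ : ∀ y, y ^ (m + 1) - (C + -1) * y ^ (m + 3) - G₀ = (y - y₀) * Q y := fun y => by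
    have h1 := geom_sum₂_mul y y₀ (m + 1)
    have h2 := geom_sum₂_mul y y₀ (m + 2 + 1)
    simp only [hQdef, hA, hG₀]
    linear_combination -h1 - (1 - C) * h2
  have hG₀pos : 0 < G₀ := by
    have := pow_pos hy₀ (m + 1)
    have := mul_nonneg (sub_nonneg.2 hC1) (pow_pos hy₀ (m + 3)).le
    rw [hG₀]; linarith
  -- `Y' ^ 2 = (Y - y₀) * (Y + y₀)` cancels the zero of `G - G₀` at `y₀` in `dt / dθ`
  set Y : ℝ → ℝ := fun x => y₀ * Real.cosh x with hYdef
  have hYl : ∀ x, y₀ ≤ Y x := fun x => le_mul_of_one_le_right hy₀.le (Real.one_le_cosh x)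
  have hYpos : ∀ x, 0 < Y x := fun x => hy₀.trans_le (hYl x)
  have hYs : ContDiff ℝ ∞ Y := contDiff_const.mul Real.contDiff_cosh
  have dY : ∀ x, HasDerivAt Y (y₀ * Real.sinh x) x := fun x =>
    (Real.hasDerivAt_cosh x).const_mul y₀
  have dY' : ∀ x, HasDerivAt (deriv Y) (y₀ * Real.cosh x) x := fun x => by
    rw [funext fun x => (dY x).deriv]
    exact (Real.hasDerivAt_sinh x).const_mul y₀
  have hYneg : ∀ x, Y (-x) = Y x := fun x => by simp [hYdef]
  have hD : ∀ x, 0 < C * Y x ^ (m + 3) + G₀ := fun x => by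
    have := pow_pos (hYpos x) (m + 3)
    positivity
  have hden : ∀ x, 0 < (1 + Y x ^ 2) * Q (Y x) := fun x =>
    mul_pos (by positivity) (hQpos _ (hYl x))
  have hnum : ∀ x, 0 < (C * Y x ^ (m + 3) + G₀) * (Y x + y₀) := fun x =>
    mul_pos (hD x) (add_pos (hYpos x) hy₀)
  set w : ℝ → ℝ := fun x =>
    √((C * Y x ^ (m + 3) + G₀) * (Y x + y₀) / ((1 + Y x ^ 2) * Q (Y x))) with hwdef
  have hrad : ∀ x, 0 < (C * Y x ^ (m + 3) + G₀) * (Y x + y₀) / ((1 + Y x ^ 2) * Q (Y x)) :=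
    fun x => div_pos (hnum x) (hden x)
  have hws : ContDiff ℝ ∞ w := by
    refine ContDiff.sqrt ?_ fun x => (hrad x).ne'
    refine ContDiff.div ?_ ?_ fun x => (hden x).ne'
    · exact ((contDiff_const.mul (hYs.pow _)).add contDiff_const).mul (hYs.add contDiff_const)
    · exact (contDiff_const.add (hYs.pow _)).mul (hQs.comp hYs)
  have hwneg : ∀ x, w (-x) = w x := fun x => by simp only [hwdef, hYneg]
  -- both sides of the quotient under the root grow like `Y ^ (m + 4)`
  set B : ℝ := (1 / y₀ ^ 2 + 1) * ((m + 1) / y₀ ^ 2 + (m + 3)) with hB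
  have hBpos : 0 < B := by positivity
  have hbound : ∀ x, C / B ≤ (C * Y x ^ (m + 3) + G₀) * (Y x + y₀) / ((1 + Y x ^ 2) * Q (Y x)) :=
    fun x => by
    have hyp := hYpos x
    have hyl := hYl x
    generalize Y x = y at hyp hyl
    have hyy : 1 ≤ y ^ 2 / y₀ ^ 2 := by
      rw [one_le_div (by positivity)]
      exact pow_le_pow_left₀ hy₀.le hyl 2
    have h1 : 1 + y ^ 2 ≤ (1 / y₀ ^ 2 + 1) * y ^ 2 := by
      rw [add_mul, one_mul, one_div_mul_eq_div]; linarith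
    have h2 : A m y ≤ (m + 1) / y₀ ^ 2 * y ^ (m + 2) := by
      refine (sum_pow_mul_pow_le hy₀ hyl m).trans ?_
      have : (m + 1) / y₀ ^ 2 * y ^ (m + 2) = ((m : ℝ) + 1) * y ^ m * (y ^ 2 / y₀ ^ 2) := by
        rw [pow_add]; ring
      rw [this]
      exact le_mul_of_one_le_right (by positivity) hyy
    have h3 : (1 - C) * A (m + 2) y ≤ (m + 3) * y ^ (m + 2) := by
      have := sum_pow_mul_pow_le hy₀ hyl (m + 2)
      push_cast at this
      have h4 : A (m + 2) y ≤ (m + 3) * y ^ (m + 2) := this.trans (le_of_eq (by ring))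
      have h5 := (hApos (m + 2) y hyl).le
      nlinarith
    have h6 : Q y ≤ ((m + 1) / y₀ ^ 2 + (m + 3)) * y ^ (m + 2) := by
      simp only [hQdef]; linarith
    have h7 : (1 + y ^ 2) * Q y ≤ B * y ^ (m + 4) := by
      refine (mul_le_mul h1 h6 (hQpos y hyl).le (by positivity)).trans (le_of_eq ?_)
      rw [hB]; ring
    have h8 : C * y ^ (m + 4) ≤ (C * y ^ (m + 3) + G₀) * (y + y₀) := by
      have : C * y ^ (m + 4) = (C * y ^ (m + 3)) * y := by ring
      rw [this]
      exact mul_le_mul (by linarith) (by linarith) hyp.le (by positivity)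
    rw [div_le_div_iff₀ hBpos (mul_pos (by positivity) (hQpos y hyl))]
    calc C * ((1 + y ^ 2) * Q y) ≤ C * (B * y ^ (m + 4)) := by gcongr
      _ = C * y ^ (m + 4) * B := by ring
      _ ≤ _ := by gcongr
  obtain ⟨T, g, hT⟩ := exists_timeChange hws (Real.sqrt_pos.2 (div_pos hC hBpos))
    fun x => Real.sqrt_le_sqrt (hbound x)
  obtain ⟨hprof, hr0, hrl, hre⟩ := exists_profile_of_quadrature (C := C) (m := m) (G₀ := G₀)
    (Or.inr rfl) hl (fun h => absurd h h1ne) hYs hT hwneg hYneg (by simp [hYdef, hy₀def]) hYl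
    (fun h => absurd h h1ne)
    (fun x => by
      have hq' := (hQpos _ (hYl x)).ne'
      rw [(dY x).deriv, hwdef]
      simp only
      rw [Real.sq_sqrt (hrad x).le, hQ (Y x), show 1 - -1 * Y x ^ 2 = 1 + Y x ^ 2 by ring]
      have hc : 1 + Y x ^ 2 ≠ 0 := by positivity
      field_simp
      have h2 : (Y x + y₀) * (Y x - y₀) = y₀ ^ 2 * Real.sinh x ^ 2 := by
        simp only [hYdef]
        linear_combination y₀ ^ 2 * Real.cosh_sq x
      linear_combination (-(C * Y x ^ (m + 3) + G₀)) * h2)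
    (fun x _ => by
      rw [(dY' x).deriv]
      exact (mul_pos hy₀ (Real.cosh_pos x)).ne')
  exact ⟨_, hprof, hr0, hrl, hre⟩

end ProfileExistence

/-! ### Scalar curvature of conformally flat metrics -/

section Conformal

open Filter Topology

variable {n : ℕ}

lemma pderiv_congr {F : Type*} [NormedAddCommGroup F] [NormedSpace ℝ F]
    {f g : (Fin n → ℝ) → F} {u : Fin n → ℝ} (h : f =ᶠ[𝓝 u] g) (i : Fin n) :
    pderiv i f u = pderiv i g u := by
  unfold pderiv; rw [h.fderiv_eq]

lemma pderiv_of_hasFDerivAt {F : Type*} [NormedAddCommGroup F] [NormedSpace ℝ F]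
    {f : (Fin n → ℝ) → F} {f' : (Fin n → ℝ) →L[ℝ] F} {u : Fin n → ℝ} (h : HasFDerivAt f f' u)
    (i : Fin n) : pderiv i f u = f' (Pi.single i 1) := by
  unfold pderiv; rw [h.fderiv]

lemma inv_smul_one {F : ℝ} (hF : F ≠ 0) :
    (F • (1 : Matrix (Fin n) (Fin n) ℝ))⁻¹ = F⁻¹ • 1 := by
  refine Matrix.inv_eq_right_inv ?_
  rw [smul_mul_smul_comm, mul_inv_cancel₀ hF, one_smul, one_mul]

lemma smul_one_apply (F : ℝ) (i j : Fin n) :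
    (F • (1 : Matrix (Fin n) (Fin n) ℝ)) i j = if i = j then F else 0 := by
  rw [Matrix.smul_apply, Matrix.one_apply]; simp

/-- The Christoffel symbols of `e^{2 f} ⟨ , ⟩`, where `F = e^{2 f}` and `φ i = ∂ᵢ f`. -/
lemma christoffel_conformal {g : (Fin n → ℝ) → Matrix (Fin n) (Fin n) ℝ}
    {F : (Fin n → ℝ) → ℝ} {φ : Fin n → (Fin n → ℝ) → ℝ} {U : Set (Fin n → ℝ)} (hU : IsOpen U)
    (hg : ∀ v ∈ U, g v = F v • 1) (hF : ∀ v ∈ U, F v ≠ 0)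
    (hφ : ∀ v ∈ U, ∀ i, pderiv i F v = 2 * F v * φ i v) {v : Fin n → ℝ} (hv : v ∈ U)
    (k i j : Fin n) :
    christoffel g k i j v = (if j = k then φ i v else 0) + (if i = k then φ j v else 0)
      - (if i = j then φ k v else 0) := by
  have hd : ∀ i j l, pderiv i (fun x => g x j l) v = if j = l then 2 * F v * φ i v else 0 :=
    fun i j l => by
    have hev : (fun x => g x j l) =ᶠ[𝓝 v] fun x => if j = l then F x else 0 := by
      filter_upwards [hU.mem_nhds hv] with x hx
      rw [hg x hx, smul_one_apply]
    rw [pderiv_congr hev]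
    split_ifs
    · exact hφ v hv i
    · simp [pderiv]
  simp only [christoffel, hd, hg v hv, inv_smul_one (hF v hv), smul_one_apply, ite_mul, zero_mul,
    Finset.sum_ite_eq, Finset.mem_univ, if_true]
  have := hF v hv
  split_ifs <;> field_simp <;> ring

/-- The scalar curvature `-e^{-2 f} (n - 1) (2 Δf + (n - 2) |∇f|²)` of `e^{2 f} ⟨ , ⟩`, where
`F = e^{2 f}` and `φ i = ∂ᵢ f`. -/
lemma scalarCurvature_conformal {g : (Fin n → ℝ) → Matrix (Fin n) (Fin n) ℝ}
    {F : (Fin n → ℝ) → ℝ} {φ : Fin n → (Fin n → ℝ) → ℝ} {U : Set (Fin n → ℝ)} (hU : IsOpen U)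
    (hg : ∀ v ∈ U, g v = F v • 1) (hF : ∀ v ∈ U, F v ≠ 0)
    (hφ : ∀ v ∈ U, ∀ i, pderiv i F v = 2 * F v * φ i v) {u : Fin n → ℝ} (hu : u ∈ U)
    (hd : ∀ i, DifferentiableAt ℝ (φ i) u) :
    scalarCurvature g u = -((n - 1) / F u) *
      (2 * ∑ i, pderiv i (φ i) u + (n - 2) * ∑ i, φ i u ^ 2) := by
  have hch : ∀ v ∈ U, ∀ k i j, christoffel g k i j v = (if j = k then φ i v else 0)
      + (if i = k then φ j v else 0) - (if i = j then φ k v else 0) := fun v hv k i j =>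
    christoffel_conformal hU hg hF hφ hv k i j
  have hdch : ∀ a k i j, pderiv a (christoffel g k i j) u =
      (if j = k then pderiv a (φ i) u else 0)
      + (if i = k then pderiv a (φ j) u else 0) - (if i = j then pderiv a (φ k) u else 0) :=
    fun a k i j => by
    have hev : christoffel g k i j =ᶠ[𝓝 u] fun v => (if j = k then φ i v else 0)
      + (if i = k then φ j v else 0) - (if i = j then φ k v else 0) := by
      filter_upwards [hU.mem_nhds hu] with v hv using hch v hv k i j
    have hite : ∀ (p : Prop) [Decidable p] (b : Fin n), HasFDerivAt
        (fun v => if p then φ b v else 0) (if p then fderiv ℝ (φ b) u else 0) u := fun p _ b => by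
      split_ifs
      · exact (hd b).hasFDerivAt
      · exact hasFDerivAt_const 0 u
    rw [pderiv_congr hev]
    refine (pderiv_of_hasFDerivAt (((hite _ _).add (hite _ _)).sub (hite _ _)) a).trans ?_
    simp only [sub_apply, add_apply, pderiv]
    split_ifs <;> simp
  have hric : ∀ j, ricci g j j u = (2 - n) * pderiv j (φ j) u - ∑ i, pderiv i (φ i) u
      + (n - 2) * φ j u ^ 2 - (n - 2) * ∑ i, φ i u ^ 2 := fun j => by
    simp only [ricci, riemann, hdch, hch u hu]
    simp only [add_mul, mul_add, sub_mul, mul_sub, ite_mul, mul_ite, zero_mul, mul_zero,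
      Finset.sum_add_distrib, Finset.sum_sub_distrib, Finset.sum_ite_eq, Finset.sum_ite_eq',
      Finset.mem_univ, if_true, Finset.sum_const, Finset.card_univ, Fintype.card_fin,
      nsmul_eq_mul, ← pow_two]
    -- the term quadratic in the Christoffel symbols leaves a double sum with one Kronecker symbol
    have hnest : ∀ f : Fin n → Fin n → ℝ,
        ∑ x, ∑ y, (if x = j then f x y else 0) = ∑ y, f j y := fun f => by
      rw [Finset.sum_comm]; simp
    simp only [hnest, Finset.sum_add_distrib, Finset.sum_sub_distrib, Finset.sum_ite_eq,
      Finset.sum_ite_eq', Finset.mem_univ, if_true, ← pow_two]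
    ring
  simp only [scalarCurvature, hg u hu, inv_smul_one (hF u hu), smul_one_apply, ite_mul, zero_mul,
    Finset.sum_ite_eq, Finset.mem_univ, if_true, hric, ← Finset.mul_sum]
  simp only [Finset.sum_add_distrib, Finset.sum_sub_distrib, ← Finset.mul_sum, Finset.sum_const,
    Finset.card_univ, Fintype.card_fin, nsmul_eq_mul]
  have := hF u hu
  field_simp
  ring

end Conformal

/-! ### The rotational hypersurface with a given profile -/

section Surface

open Filter Topology

variable {n : ℕ} {ε C : ℝ} {o : Fin (n + 1) → ℝ} {r τ σ : ℝ → ℝ}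

/-- The hypersurface of the points at height `t` and at distance `r t` from the axis; see
`geoDist_eq_iff`. -/
def rotSurface (ε : ℝ) (o : Fin (n + 1) → ℝ) (r : ℝ → ℝ) : Set (Ambient n) :=
  {p | p.1 ∈ spaceForm ε n ∧ form ε p.1 o = ε * cosE ε (r p.2)}

namespace IsCSCProfile

lemma sinE_pos (h : IsCSCProfile ε n C r) (t : ℝ) : 0 < sinE ε (r t) :=
  CSCAnnuli.sinE_pos (h.pos t) fun he => h.lt_pi_div_two he t

lemma cosE_pos (h : IsCSCProfile ε n C r) (t : ℝ) : 0 < cosE ε (r t) :=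
  CSCAnnuli.cosE_pos (h.pos t) fun he => h.lt_pi_div_two he t

lemma smooth_deriv (h : IsCSCProfile ε n C r) : ContDiff ℝ ∞ (deriv r) :=
  (contDiff_infty_iff_deriv.1 h.smooth).2

lemma hasDerivAt (h : IsCSCProfile ε n C r) (t : ℝ) : HasDerivAt r (deriv r t) t :=
  (h.smooth.differentiable (by simp) t).hasDerivAt

lemma hasDerivAt_deriv (h : IsCSCProfile ε n C r) (t : ℝ) :
    HasDerivAt (deriv r) (deriv (deriv r) t) t :=
  (h.smooth_deriv.differentiable (by simp) t).hasDerivAt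

lemma smooth_sinE (h : IsCSCProfile ε n C r) : ContDiff ℝ ∞ fun t => sinE ε (r t) :=
  contDiff_sinE.comp h.smooth

lemma smooth_cosE (h : IsCSCProfile ε n C r) : ContDiff ℝ ∞ fun t => cosE ε (r t) :=
  contDiff_cosE.comp h.smooth

lemma hasDerivAt_sinE (h : IsCSCProfile ε n C r) (t : ℝ) :
    HasDerivAt (fun t => sinE ε (r t)) (cosE ε (r t) * deriv r t) t :=
  (CSCAnnuli.hasDerivAt_sinE (r t)).comp t (h.hasDerivAt t)

lemma hasDerivAt_cosE (h : IsCSCProfile ε n C r) (hε : ε = 1 ∨ ε = -1) (t : ℝ) :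
    HasDerivAt (fun t => cosE ε (r t)) (-ε * sinE ε (r t) * deriv r t) t :=
  (CSCAnnuli.hasDerivAt_cosE hε (r t)).comp t (h.hasDerivAt t)

end IsCSCProfile

/-- The speed of the profile curve `t ↦ (r t, t)`. -/
noncomputable def speed (r : ℝ → ℝ) (t : ℝ) : ℝ := √(1 + deriv r t ^ 2)

lemma speed_pos (r : ℝ → ℝ) (t : ℝ) : 0 < speed r t := Real.sqrt_pos.2 (by positivity)

lemma speed_sq (r : ℝ → ℝ) (t : ℝ) : speed r t ^ 2 = 1 + deriv r t ^ 2 :=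
  Real.sq_sqrt (by positivity)

namespace IsCSCProfile

lemma smooth_speed (h : IsCSCProfile ε n C r) : ContDiff ℝ ∞ (speed r) :=
  (contDiff_const.add (h.smooth_deriv.pow 2)).sqrt fun t => by positivity

lemma hasDerivAt_speed (h : IsCSCProfile ε n C r) (t : ℝ) :
    HasDerivAt (speed r) (deriv r t * deriv (deriv r) t / speed r t) t := by
  have := (((h.hasDerivAt_deriv t).pow 2).const_add 1).sqrt
    (by positivity : (1 : ℝ) + deriv r t ^ 2 ≠ 0)
  refine this.congr_deriv ?_
  have := (speed_pos r t).ne'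
  change _ / (2 * speed r t) = _
  field_simp
  simp
  ring

end IsCSCProfile

lemma mem_rotSurface_iff (hε : ε = 1 ∨ ε = -1) (ho : o ∈ spaceForm ε n)
    (hc : ∀ t, 0 < cosE ε (r t)) (p : Ambient n) :
    p ∈ rotSurface ε o r ↔ form ε p.1 p.1 = ε ∧ form ε p.1 o = ε * cosE ε (r p.2) := by
  rw [rotSurface, Set.mem_ofPred_eq, mem_spaceForm_iff hε ho, and_assoc]
  refine and_congr_right fun _ => and_iff_right_of_imp fun h he => ?_
  rw [h, he]
  linarith [he ▸ hc p.2]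

lemma comb_mem_rotSurface_iff (hε : ε = 1 ∨ ε = -1) (ho : o ∈ spaceForm ε n)
    (hc : ∀ t, 0 < cosE ε (r t)) (w : Fin n → ℝ) (t : ℝ) :
    (cosE ε (r t) • o + frameEmb ε o w, t) ∈ rotSurface ε o r ↔ w ⬝ᵥ w = sinE ε (r t) ^ 2 := by
  have hε2 : ε * ε = 1 := by rcases hε with rfl | rfl <;> norm_num
  have hcs := cosE_sq_add hε (r t)
  rw [mem_rotSurface_iff hε ho hc, form_comb hε ho, form_comb_base hε ho, and_iff_left rfl]
  constructor <;> intro h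
  · linear_combination h - ε * hcs + sinE ε (r t) ^ 2 * hε2
  · linear_combination h + ε * hcs - sinE ε (r t) ^ 2 * hε2

lemma eq_comb_of_mem (hε : ε = 1 ∨ ε = -1) (ho : o ∈ spaceForm ε n) {p : Ambient n}
    (hp : p ∈ rotSurface ε o r) :
    p = (cosE ε (r p.2) • o + frameEmb ε o (frameCoord ε o p.1), p.2) := by
  have hε2 : ε * ε = 1 := by rcases hε with rfl | rfl <;> norm_num
  refine Prod.ext ?_ rfl
  conv_lhs => rw [← frame_decomp hε ho p.1, hp.2, ← mul_assoc, hε2, one_mul]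

lemma frameCoord_sq_of_mem (hε : ε = 1 ∨ ε = -1) (ho : o ∈ spaceForm ε n)
    (hc : ∀ t, 0 < cosE ε (r t)) {p : Ambient n} (hp : p ∈ rotSurface ε o r) :
    frameCoord ε o p.1 ⬝ᵥ frameCoord ε o p.1 = sinE ε (r p.2) ^ 2 := by
  have h := eq_comb_of_mem hε ho hp
  rw [h] at hp
  exact (comb_mem_rotSurface_iff hε ho hc _ _).1 hp

lemma isClosed_rotSurface (hε : ε = 1 ∨ ε = -1) (ho : o ∈ spaceForm ε n)
    (h : IsCSCProfile ε n C r) : IsClosed (rotSurface ε o r) := by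
  have hset : rotSurface ε o r =
      {p : Ambient n | form ε p.1 p.1 = ε} ∩ {p | form ε p.1 o = ε * cosE ε (r p.2)} := by
    ext p; exact mem_rotSurface_iff hε ho h.cosE_pos p
  rw [hset]
  refine IsClosed.inter (isClosed_eq ?_ continuous_const) (isClosed_eq ?_ ?_)
  · unfold form; fun_prop
  · unfold form; fun_prop
  · exact continuous_const.mul (h.smooth_cosE.continuous.comp continuous_snd)

lemma isRotational_rotSurface (hε : ε = 1 ∨ ε = -1) (ho : o ∈ spaceForm ε n)
    (h : IsCSCProfile ε n C r) : IsRotational ε o (rotSurface ε o r) := by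
  intro x t hx y hy hxy
  have hpi : ε = 1 → r t ≤ Real.pi := fun he => by
    linarith [h.lt_pi_div_two he t, Real.pi_pos]
  refine ⟨hy, ?_⟩
  rw [← geoDist_eq_iff hε ho hy (h.pos t).le hpi, hxy,
    geoDist_eq_iff hε ho hx.1 (h.pos t).le hpi]
  exact hx.2

/-! ### The global conformal chart -/

/-- `τ` is the conformal radial coordinate of the hypersurface, in which its metric is a multiple
of `dτ²` plus the metric of the unit sphere, and `σ` inverts it. -/
structure IsConformalRadius (ε : ℝ) (r τ σ : ℝ → ℝ) : Prop where
  contDiff : ContDiff ℝ ∞ τ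
  hasDerivAt : ∀ t, HasDerivAt τ (speed r t / sinE ε (r t)) t
  isOpen_range : IsOpen (Set.range τ)
  left_inv : ∀ t, σ (τ t) = t
  contDiffAt_inv : ∀ t, ContDiffAt ℝ ∞ σ (τ t)
  hasDerivAt_inv : ∀ t, HasDerivAt σ (sinE ε (r t) / speed r t) (τ t)

lemma exists_conformalRadius (h : IsCSCProfile ε n C r) : ∃ τ σ, IsConformalRadius ε r τ σ := by
  have hs : ContDiff ℝ ∞ fun t => speed r t / sinE ε (r t) :=
    h.smooth_speed.div h.smooth_sinE fun t => (h.sinE_pos t).ne'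
  obtain ⟨τ, -, hτs, hτ⟩ := exists_smooth_primitive hs
  obtain ⟨hopen, σ, hσ, hσ'⟩ := exists_smooth_leftInverse hτs hτ fun t =>
    div_pos (speed_pos r t) (h.sinE_pos t)
  exact ⟨τ, σ, hτs, hτ, hopen, hσ, fun t => (hσ' t).1, fun t => by
    simpa [inv_div] using (hσ' t).2⟩

/-- `u ⬝ᵥ ·` as a continuous linear functional. -/
noncomputable def dotL (u : Fin n → ℝ) : (Fin n → ℝ) →L[ℝ] ℝ :=
  LinearMap.toContinuousLinearMap
    { toFun := fun v => u ⬝ᵥ v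
      map_add' := dotProduct_add u
      map_smul' := fun a v => by simp }

@[simp] lemma dotL_apply (u v : Fin n → ℝ) : dotL u v = u ⬝ᵥ v := rfl

lemma hasFDerivAt_dotProduct_self (u : Fin n → ℝ) :
    HasFDerivAt (fun v : Fin n → ℝ => v ⬝ᵥ v) ((2 : ℝ) • dotL u) u := by
  have h : ∀ i, HasFDerivAt (fun v : Fin n → ℝ => v i)
      (ContinuousLinearMap.proj (R := ℝ) (φ := fun _ : Fin n => ℝ) i) u := fun i =>
    hasFDerivAt_apply i u
  have := HasFDerivAt.fun_sum (u := Finset.univ) fun i _ => (h i).mul (h i)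
  refine this.congr_fderiv ?_
  ext v
  simp [dotProduct, Finset.mul_sum, ← two_mul]

lemma contDiff_dotProduct_self : ContDiff ℝ ∞ fun v : Fin n → ℝ => v ⬝ᵥ v :=
  ContDiff.sum fun i _ => (contDiff_apply ℝ ℝ i).mul (contDiff_apply ℝ ℝ i)

/-- The annulus over which the hypersurface is parametrized. -/
def chartDomain (n : ℕ) (τ : ℝ → ℝ) : Set (Fin n → ℝ) :=
  {u | 0 < u ⬝ᵥ u ∧ Real.log (u ⬝ᵥ u) / 2 ∈ Set.range τ}

/-- The height of the point with parameter `u`: the solution `t` of `τ t = log |u|`. -/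
noncomputable def chartHeight (σ : ℝ → ℝ) (u : Fin n → ℝ) : ℝ := σ (Real.log (u ⬝ᵥ u) / 2)

/-- The rotationally equivariant map with components `a`, `b`, `h` along `o`, along the radial
direction of the frame and along the axis. -/
noncomputable def lift (ε : ℝ) (o : Fin (n + 1) → ℝ) (σ a b h : ℝ → ℝ) (u : Fin n → ℝ) :
    Ambient n :=
  (a (chartHeight σ u) • o + b (chartHeight σ u) • frameEmb ε o u, h (chartHeight σ u))

namespace IsConformalRadius

lemma isOpen_chartDomain (hτ : IsConformalRadius ε r τ σ) : IsOpen (chartDomain n τ) := by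
  have hc : Continuous fun u : Fin n → ℝ => u ⬝ᵥ u := contDiff_dotProduct_self.continuous
  have hU : IsOpen {u : Fin n → ℝ | 0 < u ⬝ᵥ u} := isOpen_lt continuous_const hc
  have hcont : ContinuousOn (fun u : Fin n → ℝ => Real.log (u ⬝ᵥ u) / 2)
      {u : Fin n → ℝ | 0 < u ⬝ᵥ u} :=
    (ContinuousOn.log hc.continuousOn fun u hu => ne_of_gt hu).div_const 2
  exact hcont.isOpen_inter_preimage hU hτ.isOpen_range

lemma log_eq (hτ : IsConformalRadius ε r τ σ) {u : Fin n → ℝ} (hu : u ∈ chartDomain n τ) :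
    Real.log (u ⬝ᵥ u) / 2 = τ (chartHeight σ u) := by
  obtain ⟨-, t, ht⟩ := hu
  rw [chartHeight, ← ht, hτ.left_inv]

lemma dot_eq (hτ : IsConformalRadius ε r τ σ) {u : Fin n → ℝ} (hu : u ∈ chartDomain n τ) :
    u ⬝ᵥ u = (Real.exp (-τ (chartHeight σ u)) ^ 2)⁻¹ := by
  rw [← hτ.log_eq hu, ← Real.exp_nat_mul, ← Real.exp_neg]
  rw [show -(((2 : ℕ) : ℝ) * -(Real.log (u ⬝ᵥ u) / 2)) = Real.log (u ⬝ᵥ u) by push_cast; ring,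
    Real.exp_log hu.1]

lemma mem_chartDomain (hτ : IsConformalRadius ε r τ σ) {u : Fin n → ℝ} {t : ℝ}
    (h : u ⬝ᵥ u = Real.exp (τ t) ^ 2) : u ∈ chartDomain n τ ∧ chartHeight σ u = t := by
  have hlog : Real.log (u ⬝ᵥ u) / 2 = τ t := by
    rw [h, Real.log_pow, Real.log_exp]; push_cast; ring
  refine ⟨⟨by rw [h]; positivity, t, hlog.symm⟩, ?_⟩
  rw [chartHeight, hlog, hτ.left_inv]

lemma contDiffAt_chartHeight (hτ : IsConformalRadius ε r τ σ) {u : Fin n → ℝ}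
    (hu : u ∈ chartDomain n τ) : ContDiffAt ℝ ∞ (chartHeight (n := n) σ) u := by
  have h1 : ContDiffAt ℝ ∞ (fun u : Fin n → ℝ => Real.log (u ⬝ᵥ u) / 2) u :=
    (contDiff_dotProduct_self.contDiffAt.log hu.1.ne').div_const 2
  refine ContDiffAt.comp (g := σ) u ?_ h1
  rw [hτ.log_eq hu]
  exact hτ.contDiffAt_inv _

lemma hasFDerivAt_chartHeight (hτ : IsConformalRadius ε r τ σ) {u : Fin n → ℝ}
    (hu : u ∈ chartDomain n τ) : HasFDerivAt (chartHeight (n := n) σ)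
      ((Real.exp (-τ (chartHeight σ u)) ^ 2 * sinE ε (r (chartHeight σ u)) /
        speed r (chartHeight σ u)) • dotL u) u := by
  have h1 := ((hasFDerivAt_dotProduct_self u).log hu.1.ne').mul_const (2⁻¹ : ℝ)
  have h2 : HasDerivAt σ (sinE ε (r (chartHeight σ u)) / speed r (chartHeight σ u))
      (Real.log (u ⬝ᵥ u) * 2⁻¹) := by
    rw [← div_eq_mul_inv, hτ.log_eq hu]
    exact hτ.hasDerivAt_inv (chartHeight σ u)
  refine (h2.comp_hasFDerivAt u h1).congr_fderiv ?_
  rw [hτ.dot_eq hu, inv_inv]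
  ext v
  simp
  ring

/-- Chain rule for functions of the height. -/
lemma hasFDerivAt_comp_chartHeight (hτ : IsConformalRadius ε r τ σ) {u : Fin n → ℝ}
    (hu : u ∈ chartDomain n τ) {f : ℝ → ℝ} {f' : ℝ} (hf : HasDerivAt f f' (chartHeight σ u)) :
    HasFDerivAt (fun v : Fin n → ℝ => f (chartHeight σ v))
      ((f' * (Real.exp (-τ (chartHeight σ u)) ^ 2 * sinE ε (r (chartHeight σ u)) /
        speed r (chartHeight σ u))) • dotL u) u := by
  have := hf.comp_hasFDerivAt u (hτ.hasFDerivAt_chartHeight hu)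
  rwa [smul_smul] at this

lemma pderiv_lift (hτ : IsConformalRadius ε r τ σ) {u : Fin n → ℝ}
    (hu : u ∈ chartDomain n τ) {a b h : ℝ → ℝ} {a' b' h' κ : ℝ}
    (hκ : κ = Real.exp (-τ (chartHeight σ u)) ^ 2 * sinE ε (r (chartHeight σ u)) /
        speed r (chartHeight σ u))
    (ha : HasDerivAt a a' (chartHeight σ u)) (hb : HasDerivAt b b' (chartHeight σ u))
    (hh : HasDerivAt h h' (chartHeight σ u)) (i : Fin n) :
    pderiv i (lift ε o σ a b h) u = ((κ * u i * a') • o + frameEmb ε o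
      ((κ * u i * b') • u + b (chartHeight σ u) • Pi.single i 1), κ * u i * h') := by
  have h1 := ((hτ.hasFDerivAt_comp_chartHeight hu ha).smul_const o).add
    ((hτ.hasFDerivAt_comp_chartHeight hu hb).smul (frameEmb ε o).hasFDerivAt)
  have h2 := h1.prodMk (hτ.hasFDerivAt_comp_chartHeight hu hh)
  refine (pderiv_of_hasFDerivAt h2 i).trans (Prod.ext ?_ ?_)
  · simp [hκ, map_add, map_smul]
    ext j
    simp
    ring
  · simp [hκ]
    ring

lemma prodForm_pderiv_lift (hτ : IsConformalRadius ε r τ σ) (hε : ε = 1 ∨ ε = -1)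
    (ho : o ∈ spaceForm ε n) {u : Fin n → ℝ}
    (hu : u ∈ chartDomain n τ) {a₁ b₁ h₁ a₂ b₂ h₂ : ℝ → ℝ} {a₁' b₁' h₁' a₂' b₂' h₂' κ : ℝ}
    (hκ : κ = Real.exp (-τ (chartHeight σ u)) ^ 2 * sinE ε (r (chartHeight σ u)) /
        speed r (chartHeight σ u))
    (ha₁ : HasDerivAt a₁ a₁' (chartHeight σ u)) (hb₁ : HasDerivAt b₁ b₁' (chartHeight σ u))
    (hh₁ : HasDerivAt h₁ h₁' (chartHeight σ u)) (ha₂ : HasDerivAt a₂ a₂' (chartHeight σ u))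
    (hb₂ : HasDerivAt b₂ b₂' (chartHeight σ u)) (hh₂ : HasDerivAt h₂ h₂' (chartHeight σ u))
    (i j : Fin n) :
    prodForm ε (pderiv i (lift ε o σ a₁ b₁ h₁) u) (pderiv j (lift ε o σ a₂ b₂ h₂) u) =
      (if i = j then b₁ (chartHeight σ u) * b₂ (chartHeight σ u) else 0) +
      (κ ^ 2 * (ε * a₁' * a₂' + b₁' * b₂' * (u ⬝ᵥ u) + h₁' * h₂') +
        κ * (b₁' * b₂ (chartHeight σ u) + b₁ (chartHeight σ u) * b₂')) * (u i * u j) := by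
  rw [hτ.pderiv_lift hu hκ ha₁ hb₁ hh₁, hτ.pderiv_lift hu hκ ha₂ hb₂ hh₂, prodForm,
    form_comb hε ho]
  simp only [add_dotProduct, dotProduct_add, smul_dotProduct, dotProduct_smul, smul_eq_mul,
    Pi.add_apply, Pi.smul_apply, single_one_dotProduct, dotProduct_single_one, Pi.single_apply, eq_comm (a := j)]
  split_ifs <;> ring

lemma contDiffOn_lift (hτ : IsConformalRadius ε r τ σ) {a b h : ℝ → ℝ} (ha : ContDiff ℝ ∞ a)
    (hb : ContDiff ℝ ∞ b) (hh : ContDiff ℝ ∞ h) :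
    ContDiffOn ℝ ∞ (lift ε o σ a b h) (chartDomain n τ) := fun u hu => by
  have hH := hτ.contDiffAt_chartHeight hu
  have h1 : ContDiffAt ℝ ∞ (fun v : Fin n → ℝ => a (chartHeight σ v)) u := ha.contDiffAt.comp u hH
  have h2 : ContDiffAt ℝ ∞ (fun v : Fin n → ℝ => b (chartHeight σ v)) u := hb.contDiffAt.comp u hH
  have h3 : ContDiffAt ℝ ∞ (fun v : Fin n → ℝ => h (chartHeight σ v)) u := hh.contDiffAt.comp u hH
  exact (((h1.smul contDiffAt_const).add
    (h2.smul (frameEmb ε o).contDiff.contDiffAt)).prodMk h3).contDiffWithinAt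

end IsConformalRadius

/-- The radial component of the chart: the ratio of the radii of the orbit and of the
parameter. -/
noncomputable def chartRadial (ε : ℝ) (r τ : ℝ → ℝ) (t : ℝ) : ℝ :=
  sinE ε (r t) * Real.exp (-τ t)

/-- The global parametrization of the hypersurface, conformal by the choice of `τ`. -/
noncomputable def chart (ε : ℝ) (o : Fin (n + 1) → ℝ) (r τ σ : ℝ → ℝ) :
    (Fin n → ℝ) → Ambient n :=
  lift ε o σ (fun t => cosE ε (r t)) (chartRadial ε r τ) id

/-- The unit normal along `chart`. -/
noncomputable def chartNormal (ε : ℝ) (o : Fin (n + 1) → ℝ) (r τ σ : ℝ → ℝ) :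
    (Fin n → ℝ) → Ambient n :=
  lift ε o σ (fun t => ε * sinE ε (r t) / speed r t)
    (fun t => -(cosE ε (r t) * Real.exp (-τ t) / speed r t)) (fun t => deriv r t / speed r t)

/-- The inverse of `chart`, extended to the ambient space. -/
noncomputable def chartInv (ε : ℝ) (o : Fin (n + 1) → ℝ) (r τ : ℝ → ℝ) (p : Ambient n) :
    Fin n → ℝ :=
  (Real.exp (τ p.2) / sinE ε (r p.2)) • frameCoord ε o p.1

section Chart

lemma contDiff_chartInv (h : IsCSCProfile ε n C r) (hτ : IsConformalRadius ε r τ σ) :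
    ContDiff ℝ ∞ (chartInv ε o r τ) := by
  have h1 : ContDiff ℝ ∞ fun t => Real.exp (τ t) / sinE ε (r t) :=
    hτ.contDiff.exp.div h.smooth_sinE fun t => (h.sinE_pos t).ne'
  exact (h1.comp contDiff_snd).smul ((frameCoord ε o).contDiff.comp contDiff_fst)

lemma chartInv_chart (hε : ε = 1 ∨ ε = -1) (ho : o ∈ spaceForm ε n) (h : IsCSCProfile ε n C r)
    (u : Fin n → ℝ) : chartInv ε o r τ (chart ε o r τ σ u) = u := by
  have hs := (h.sinE_pos (chartHeight σ u)).ne'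
  simp only [chartInv, chart, lift, id]
  rw [← map_smul (frameEmb ε o), frameCoord_comb hε ho, smul_smul, chartRadial, Real.exp_neg]
  have := (Real.exp_pos (τ (chartHeight σ u))).ne'
  field_simp
  rw [one_smul]

lemma chart_chartInv (hε : ε = 1 ∨ ε = -1) (ho : o ∈ spaceForm ε n) (h : IsCSCProfile ε n C r)
    (hτ : IsConformalRadius ε r τ σ) {p : Ambient n} (hp : p ∈ rotSurface ε o r) :
    chartInv ε o r τ p ∈ chartDomain n τ ∧ chart ε o r τ σ (chartInv ε o r τ p) = p := by
  have hs := (h.sinE_pos p.2).ne'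
  have hw := frameCoord_sq_of_mem hε ho h.cosE_pos hp
  have hq : chartInv ε o r τ p ⬝ᵥ chartInv ε o r τ p = Real.exp (τ p.2) ^ 2 := by
    simp only [chartInv, smul_dotProduct, dotProduct_smul, hw, smul_eq_mul]
    field_simp
  obtain ⟨hmem, ht⟩ := hτ.mem_chartDomain hq
  refine ⟨hmem, ?_⟩
  conv_rhs => rw [eq_comb_of_mem hε ho hp]
  simp only [chart, lift, ht, id]
  simp only [chartInv, map_smul, smul_smul, chartRadial, Real.exp_neg]
  have := (Real.exp_pos (τ p.2)).ne'
  rw [show sinE ε (r p.2) * (Real.exp (τ p.2))⁻¹ * (Real.exp (τ p.2) / sinE ε (r p.2)) = 1 by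
    field_simp, one_smul]

lemma chart_mem (hε : ε = 1 ∨ ε = -1) (ho : o ∈ spaceForm ε n) (h : IsCSCProfile ε n C r)
    (hτ : IsConformalRadius ε r τ σ) {u : Fin n → ℝ} (hu : u ∈ chartDomain n τ) :
    chart ε o r τ σ u ∈ rotSurface ε o r := by
  simp only [chart, lift, id, ← map_smul]
  rw [comb_mem_rotSurface_iff hε ho h.cosE_pos, smul_dotProduct, dotProduct_smul, hτ.dot_eq hu,
    chartRadial, smul_eq_mul, smul_eq_mul]
  have := (Real.exp_pos (-τ (chartHeight σ u))).ne'
  field_simp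

lemma smooth_exp_neg (hτ : IsConformalRadius ε r τ σ) : ContDiff ℝ ∞ fun t => Real.exp (-τ t) :=
  hτ.contDiff.neg.exp

lemma isLocalParametrization_chart (hε : ε = 1 ∨ ε = -1) (ho : o ∈ spaceForm ε n)
    (h : IsCSCProfile ε n C r) (hτ : IsConformalRadius ε r τ σ) :
    IsLocalParametrization (rotSurface ε o r) (chartDomain n τ) (chart ε o r τ σ) := by
  have hsm : ContDiffOn ℝ ∞ (chart ε o r τ σ) (chartDomain n τ) :=
    hτ.contDiffOn_lift h.smooth_cosE (h.smooth_sinE.mul (smooth_exp_neg hτ)) contDiff_id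
  have hopen := hτ.isOpen_chartDomain (n := n)
  refine ⟨hopen, hsm, fun u hu => ?_, ?_, Set.univ, isOpen_univ, ?_⟩
  -- the differential is injective and the map an embedding since `chartInv` is a smooth left inverse
  · have h1 : HasFDerivAt (chart ε o r τ σ) (fderiv ℝ (chart ε o r τ σ) u) u :=
      ((hsm.contDiffAt (hopen.mem_nhds hu)).differentiableAt (by simp)).hasFDerivAt
    have h2 := ((contDiff_chartInv (o := o) h hτ).differentiable (by simp)
      (chart ε o r τ σ u)).hasFDerivAt
    have h3 := (h2.comp u h1).congr_of_eventuallyEq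
      (Eventually.of_forall fun v => (chartInv_chart (τ := τ) (σ := σ) hε ho h v).symm)
    have h4 := h3.unique (hasFDerivAt_id u)
    exact Function.LeftInverse.injective fun v => DFunLike.congr_fun h4 v
  · refine IsEmbedding.of_comp hsm.continuousOn.domRestrict
      (contDiff_chartInv (o := o) h hτ).continuous ?_
    have : (chartInv ε o r τ ∘ fun u : chartDomain n τ => chart ε o r τ σ u) = Subtype.val :=
      funext fun u => chartInv_chart hε ho h _
    rw [this]
    exact .subtypeVal
  · rw [Set.inter_univ]
    ext p
    constructor
    · rintro ⟨u, hu, rfl⟩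
      exact chart_mem hε ho h hτ hu
    · intro hp
      obtain ⟨h1, h2⟩ := chart_chartInv (C := C) hε ho h hτ hp
      exact ⟨_, h1, h2⟩

lemma isProperlyEmbedded_rotSurface (hε : ε = 1 ∨ ε = -1) (ho : o ∈ spaceForm ε n)
    (h : IsCSCProfile ε n C r) : IsProperlyEmbeddedHypersurface ε (rotSurface ε o r) := by
  obtain ⟨τ, σ, hτ⟩ := exists_conformalRadius h
  refine ⟨fun p hp => hp.1, isClosed_rotSurface hε ho h, fun p hp => ?_⟩
  obtain ⟨h1, h2⟩ := chart_chartInv (C := C) hε ho h hτ hp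
  exact ⟨_, _, isLocalParametrization_chart hε ho h hτ, _, h1, h2⟩

end Chart

end Surface

/-! ### Curvature of the hypersurface -/

section Curvature

open Filter Topology

variable {n : ℕ} {ε C : ℝ} {o : Fin (n + 1) → ℝ} {r τ σ : ℝ → ℝ}

lemma hasDerivAt_exp_neg (hτ : IsConformalRadius ε r τ σ) (t : ℝ) :
    HasDerivAt (fun t => Real.exp (-τ t))
      (-(Real.exp (-τ t) * (speed r t / sinE ε (r t)))) t :=
  (hτ.hasDerivAt t).neg.exp.congr_deriv (by simp)

lemma hasDerivAt_chartRadial (h : IsCSCProfile ε n C r) (hτ : IsConformalRadius ε r τ σ) (t : ℝ) :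
    HasDerivAt (chartRadial ε r τ)
      (Real.exp (-τ t) * (cosE ε (r t) * deriv r t - speed r t)) t := by
  refine ((h.hasDerivAt_sinE t).mul (hasDerivAt_exp_neg hτ t)).congr_deriv ?_
  have := (h.sinE_pos t).ne'
  field_simp
  ring

/-- The coefficient of `u uᵀ` in the induced metric vanishes by the choice of `τ`. -/
lemma inducedMetric_chart (hε : ε = 1 ∨ ε = -1) (ho : o ∈ spaceForm ε n)
    (h : IsCSCProfile ε n C r) (hτ : IsConformalRadius ε r τ σ) {u : Fin n → ℝ}
    (hu : u ∈ chartDomain n τ) :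
    inducedMetric ε (chart ε o r τ σ) u =
      (chartRadial ε r τ (chartHeight σ u) ^ 2) • (1 : Matrix (Fin n) (Fin n) ℝ) := by
  ext i j
  set t := chartHeight σ u with ht
  have hd := hτ.prodForm_pderiv_lift hε ho hu rfl (h.hasDerivAt_cosE hε t)
    (hasDerivAt_chartRadial h hτ t) (hasDerivAt_id t) (h.hasDerivAt_cosE hε t)
    (hasDerivAt_chartRadial h hτ t) (hasDerivAt_id t) i j
  rw [smul_one_apply, inducedMetric, Matrix.of_apply, chart, hd, hτ.dot_eq hu, ← ht]
  have hs := (h.sinE_pos t).ne'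
  have hv := (speed_pos r t).ne'
  have hE := (Real.exp_pos (-τ t)).ne'
  have hcs := cosE_sq_add hε (r t)
  have hv2 := speed_sq r t
  have hε2 : ε ^ 2 = 1 := by rcases hε with rfl | rfl <;> norm_num
  rw [add_eq_left.2, ← pow_two]
  rw [mul_eq_zero]
  left
  rw [chartRadial]
  field_simp
  linear_combination (Real.exp (-τ t)) ^ 4 * sinE ε (r t) ^ 2 * (deriv r t ^ 2 * hcs - hv2
    + ε * sinE ε (r t) ^ 2 * deriv r t ^ 2 * hε2)

/-- The chart is conformal, so its metric falls under `scalarCurvature_conformal`; the value is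
constant by the profile equation. -/
lemma scalarCurvature_chart (hε : ε = 1 ∨ ε = -1) (ho : o ∈ spaceForm ε n)
    (h : IsCSCProfile ε n C r) (hτ : IsConformalRadius ε r τ σ) {u : Fin n → ℝ}
    (hu : u ∈ chartDomain n τ) :
    scalarCurvature (inducedMetric ε (chart ε o r τ σ)) u = n * (n - 1) * (C + ε) := by
  -- `L (t u) * u i` is the `i`-th partial derivative of `log (chartRadial (t u))`, where `t u` is
  -- the height of the point with parameter `u`
  set L : ℝ → ℝ := fun t => Real.exp (-τ t) ^ 2 * (cosE ε (r t) * deriv r t / speed r t - 1)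
    with hL
  set t := chartHeight σ u with ht
  have hs := (h.sinE_pos t).ne'
  have hv := (speed_pos r t).ne'
  have hE := (Real.exp_pos (-τ t)).ne'
  obtain ⟨L', hL', dL⟩ : ∃ L', L' = Real.exp (-τ t) ^ 2 * (-2 * (speed r t / sinE ε (r t)) *
      (cosE ε (r t) * deriv r t / speed r t - 1) + (-ε * sinE ε (r t) * deriv r t ^ 2 / speed r t
        + cosE ε (r t) * deriv (deriv r) t / speed r t ^ 3)) ∧ HasDerivAt L L' t := by
    refine ⟨_, rfl, (((hasDerivAt_exp_neg hτ t).pow 2).mul ((((h.hasDerivAt_cosE hε t).mul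
      (h.hasDerivAt_deriv t)).div (h.hasDerivAt_speed t) hv).sub_const 1)).congr_deriv ?_⟩
    simp only [Nat.cast_ofNat, Pi.pow_apply, Pi.mul_apply, Pi.div_apply]
    have hv2 := speed_sq r t
    field_simp
    linear_combination
      (Real.exp (-τ t) * cosE ε (r t) * deriv (deriv r) t * sinE ε (r t)) * hv2
  have hφ : ∀ i, HasFDerivAt (fun v : Fin n → ℝ => L (chartHeight σ v) * v i)
      (L t • ContinuousLinearMap.proj (R := ℝ) (φ := fun _ : Fin n => ℝ) i + u i •
        ((L' * (Real.exp (-τ t) ^ 2 * sinE ε (r t) / speed r t)) • dotL u)) u := fun i =>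
    (hτ.hasFDerivAt_comp_chartHeight hu dL).mul (hasFDerivAt_apply i u)
  have hφ' : ∀ i, pderiv i (fun v : Fin n → ℝ => L (chartHeight σ v) * v i) u =
      L t + L' * (Real.exp (-τ t) ^ 2 * sinE ε (r t) / speed r t) * u i ^ 2 := fun i => by
    rw [pderiv_of_hasFDerivAt (hφ i)]
    simp
    ring
  have hF : ∀ v ∈ chartDomain n τ, chartRadial ε r τ (chartHeight σ v) ^ 2 ≠ 0 := fun v _ =>
    pow_ne_zero _ (mul_pos (h.sinE_pos _) (Real.exp_pos _)).ne'
  rw [scalarCurvature_conformal hτ.isOpen_chartDomain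
    (F := fun v => chartRadial ε r τ (chartHeight σ v) ^ 2)
    (φ := fun i v => L (chartHeight σ v) * v i)
    (fun v hv => inducedMetric_chart hε ho h hτ hv) hF ?_ hu fun i => (hφ i).differentiableAt]
  · simp only [hφ', Finset.sum_add_distrib, ← Finset.mul_sum, Finset.sum_const, Finset.card_univ,
      Fintype.card_fin, nsmul_eq_mul, mul_pow, ← ht]
    rw [show ∑ i, u i ^ 2 = u ⬝ᵥ u by simp [dotProduct, pow_two], hτ.dot_eq hu, ← ht, hL',
      chartRadial]
    simp only [hL]
    have hcs := cosE_sq_add hε (r t)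
    have hv2 := speed_sq r t
    have hode := h.ode t
    rw [← hv2] at hode
    have hr2 : deriv r t ^ 2 = speed r t ^ 2 - 1 := by linarith
    have hc2 : cosE ε (r t) ^ 2 = 1 - ε * sinE ε (r t) ^ 2 := by linarith
    field_simp
    generalize speed r t = v at *
    generalize deriv (deriv r) t = r2 at *
    generalize deriv r t = r1 at *
    generalize sinE ε (r t) = s at *
    generalize cosE ε (r t) = c at *
    linear_combination (-(n - 1) : ℝ) * hode
      - (n - 1) * ((n - 2) * v ^ 2 * c ^ 2 - 2 * ε * s ^ 2 * v ^ 2) * hr2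
      - (n - 1) * (n - 2) * v ^ 4 * hc2
  · intro v hv i
    have hd : HasDerivAt (fun t => chartRadial ε r τ t ^ 2) _ (chartHeight σ v) :=
      (hasDerivAt_chartRadial h hτ (chartHeight σ v)).pow 2
    rw [pderiv_of_hasFDerivAt (hτ.hasFDerivAt_comp_chartHeight hv hd)]
    have := (speed_pos r (chartHeight σ v)).ne'
    simp [hL, chartRadial]
    field_simp

lemma chart_hasConstantScalarCurvature (hε : ε = 1 ∨ ε = -1) (ho : o ∈ spaceForm ε n)
    (h : IsCSCProfile ε n C r) :
    HasConstantScalarCurvature ε (rotSurface ε o r) (n * (n - 1) * (C + ε)) := by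
  obtain ⟨τ, σ, hτ⟩ := exists_conformalRadius h
  intro p hp
  obtain ⟨h1, h2⟩ := chart_chartInv (C := C) hε ho h hτ hp
  exact ⟨_, _, _, isLocalParametrization_chart hε ho h hτ, h1, h2,
    scalarCurvature_chart hε ho h hτ h1⟩

/-! ### Principal curvatures -/

lemma isUnitNormal_chartNormal (hε : ε = 1 ∨ ε = -1) (ho : o ∈ spaceForm ε n)
    (h : IsCSCProfile ε n C r) (hτ : IsConformalRadius ε r τ σ) :
    IsUnitNormal ε (chartDomain n τ) (chart ε o r τ σ) (chartNormal ε o r τ σ) := by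
  have hε2 : ε ^ 2 = 1 := by rcases hε with rfl | rfl <;> norm_num
  have hvne : ∀ t, speed r t ≠ 0 := fun t => (speed_pos r t).ne'
  refine ⟨hτ.contDiffOn_lift ((contDiff_const.mul h.smooth_sinE).div h.smooth_speed hvne)
    ((h.smooth_cosE.mul (smooth_exp_neg hτ)).div h.smooth_speed hvne).neg
    (h.smooth_deriv.div h.smooth_speed hvne), fun u hu => ?_, fun u hu => ?_, fun u hu i => ?_⟩
  · have hE := (Real.exp_pos (-τ (chartHeight σ u))).ne'
    have hv := hvne (chartHeight σ u)
    have hv2 := speed_sq r (chartHeight σ u)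
    have hcs := cosE_sq_add hε (r (chartHeight σ u))
    simp only [prodForm, chartNormal, lift, ← map_smul (frameEmb ε o)]
    rw [form_comb hε ho]
    simp only [smul_dotProduct, dotProduct_smul, smul_eq_mul, hτ.dot_eq hu]
    field_simp
    linear_combination hcs - hv2 + ε * sinE ε (r (chartHeight σ u)) ^ 2 * hε2
  · have hE := (Real.exp_pos (-τ (chartHeight σ u))).ne'
    have hv := hvne (chartHeight σ u)
    simp only [chartNormal, chart, lift, ← map_smul (frameEmb ε o)]
    rw [form_comb hε ho]
    simp only [smul_dotProduct, dotProduct_smul, smul_eq_mul, hτ.dot_eq hu, chartRadial]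
    field_simp
    linear_combination (sinE ε (r (chartHeight σ u)) * cosE ε (r (chartHeight σ u))) * hε2
  · have hE := (Real.exp_pos (-τ (chartHeight σ u))).ne'
    have hv := hvne (chartHeight σ u)
    have hs := (h.sinE_pos (chartHeight σ u)).ne'
    have hcs := cosE_sq_add hε (r (chartHeight σ u))
    rw [chart, hτ.pderiv_lift hu rfl (h.hasDerivAt_cosE hε _)
      (hasDerivAt_chartRadial h hτ _) (hasDerivAt_id _)]
    simp only [prodForm, chartNormal, lift, ← map_smul (frameEmb ε o)]
    rw [form_comb hε ho]
    simp only [smul_dotProduct, dotProduct_add, dotProduct_smul, smul_eq_mul,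
      dotProduct_single_one, hτ.dot_eq hu, chartRadial, Pi.smul_apply]
    generalize Real.exp (-τ (chartHeight σ u)) = E at *
    generalize speed r (chartHeight σ u) = v at *
    generalize deriv r (chartHeight σ u) = r1 at *
    generalize sinE ε (r (chartHeight σ u)) = s at *
    generalize cosE ε (r (chartHeight σ u)) = c at *
    field_simp
    linear_combination (s * E ^ 2 * u i * r1) * (-hcs - ε * s ^ 2 * hε2)

lemma charpoly_smul_one_add_vecMulVec (hn : 1 ≤ n) (α β : ℝ) (u : Fin n → ℝ) :
    (α • (1 : Matrix (Fin n) (Fin n) ℝ) + β • Matrix.vecMulVec u u).charpoly =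
      (Polynomial.X - Polynomial.C (α + β * (u ⬝ᵥ u))) *
        (Polynomial.X - Polynomial.C α) ^ (n - 1) := by
  have h1 : α • (1 : Matrix (Fin n) (Fin n) ℝ) + β • Matrix.vecMulVec u u =
      Matrix.vecMulVec (β • u) u - Matrix.scalar (Fin n) (-α) := by
    rw [Matrix.smul_vecMulVec, map_neg, sub_neg_eq_add, add_comm, Matrix.smul_one_eq_diagonal]
    rfl
  rw [h1, Matrix.charpoly_sub_scalar, Matrix.charpoly_vecMulVec]
  obtain ⟨m, rfl⟩ := Nat.exists_eq_add_of_le' hn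
  simp [Polynomial.smul_eq_C_mul, pow_succ]
  ring

lemma two_mul_sum_Ioi (k : Fin n → ℝ) :
    2 * ∑ i, ∑ j ∈ Finset.Ioi i, k i * k j = (∑ i, k i) ^ 2 - ∑ i, k i ^ 2 := by
  induction n with
  | zero => simp
  | succ m ih =>
    have := ih (fun i => k i.succ)
    simp only [Fin.sum_univ_succ, Fin.sum_Ioi_zero, Fin.sum_Ioi_succ]
    rw [mul_add, this, ← Finset.mul_sum]
    ring

/-- The principal curvatures are those of the orbits, with multiplicity `n - 1`, and the curvature
of the profile curve. -/
lemma shapeOperator_chart (hε : ε = 1 ∨ ε = -1) (ho : o ∈ spaceForm ε n)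
    (h : IsCSCProfile ε n C r) (hτ : IsConformalRadius ε r τ σ) {u : Fin n → ℝ}
    (hu : u ∈ chartDomain n τ) : ∃ α β : ℝ,
    shapeOperator ε (chart ε o r τ σ) (chartNormal ε o r τ σ) u =
      α • (1 : Matrix (Fin n) (Fin n) ℝ) + β • Matrix.vecMulVec u u ∧
    α = cosE ε (r (chartHeight σ u)) / (sinE ε (r (chartHeight σ u)) * speed r (chartHeight σ u)) ∧
    α + β * (u ⬝ᵥ u) = -(deriv (deriv r) (chartHeight σ u) / speed r (chartHeight σ u) ^ 3) := by
  have hε2 : ε ^ 2 = 1 := by rcases hε with rfl | rfl <;> norm_num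
  set t := chartHeight σ u with ht
  have hs := (h.sinE_pos t).ne'
  have hv := (speed_pos r t).ne'
  have hE := (Real.exp_pos (-τ t)).ne'
  have hcs := cosE_sq_add hε (r t)
  have hv2 := speed_sq r t
  have dP : HasDerivAt (fun t => ε * sinE ε (r t) / speed r t)
      (ε * (cosE ε (r t) * deriv r t / speed r t
        - sinE ε (r t) * deriv r t * deriv (deriv r) t / speed r t ^ 3)) t := by
    refine (((h.hasDerivAt_sinE t).const_mul ε).div (h.hasDerivAt_speed t) hv).congr_deriv ?_
    field_simp
  have dQ : HasDerivAt (fun t => -(cosE ε (r t) * Real.exp (-τ t) / speed r t))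
      (Real.exp (-τ t) * (ε * sinE ε (r t) * deriv r t / speed r t
        + cosE ε (r t) * deriv r t * deriv (deriv r) t / speed r t ^ 3
        + cosE ε (r t) / sinE ε (r t))) t := by
    refine (((h.hasDerivAt_cosE hε t).mul (hasDerivAt_exp_neg hτ t)).div
      (h.hasDerivAt_speed t) hv).neg.congr_deriv ?_
    simp only [Pi.mul_apply]
    field_simp
    ring
  have dZ : HasDerivAt (fun t => deriv r t / speed r t)
      (deriv (deriv r) t / speed r t ^ 3) t := by
    refine ((h.hasDerivAt_deriv t).div (h.hasDerivAt_speed t) hv).congr_deriv ?_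
    field_simp
    linear_combination (deriv (deriv r) t) * hv2
  have hd := hτ.prodForm_pderiv_lift hε ho hu rfl dP dQ dZ (h.hasDerivAt_cosE hε t)
    (hasDerivAt_chartRadial h hτ t) (hasDerivAt_id t)
  refine ⟨_, (-(deriv (deriv r) t / speed r t ^ 3) -
    cosE ε (r t) / (sinE ε (r t) * speed r t)) * Real.exp (-τ t) ^ 2, ?_, rfl, ?_⟩
  · have hB : chartRadial ε r τ (chartHeight σ u) ^ 2 ≠ 0 :=
      pow_ne_zero _ (mul_pos (h.sinE_pos _) (Real.exp_pos _)).ne'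
    rw [shapeOperator, inducedMetric_chart hε ho h hτ hu, inv_smul_one hB, smul_mul_assoc, one_mul]
    ext i j
    rw [Matrix.smul_apply, secondFundamentalForm, Matrix.of_apply, chart, chartNormal, hd i j,
      hτ.dot_eq hu, Matrix.add_apply, smul_one_apply, Matrix.smul_apply, Matrix.vecMulVec_apply,
      ← ht, chartRadial, smul_eq_mul, smul_eq_mul]
    generalize speed r t = v at *
    generalize deriv (deriv r) t = r2 at *
    generalize deriv r t = r1 at *
    generalize sinE ε (r t) = s at *
    generalize cosE ε (r t) = c at *
    generalize Real.exp (-τ t) = E at *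
    generalize u i * u j = uu at *
    clear hd dP dQ dZ hB
    split_ifs
    · field_simp
      linear_combination (-E ^ 2 * uu) *
        (-s ^ 2 * ε * r1 ^ 2 * (c * v ^ 2 - s * r2) * hε2 + s * r1 ^ 2 * r2 * hcs - s * r2 * hv2)
    · field_simp
      linear_combination (-s * E ^ 4 * uu) *
        (-s ^ 2 * ε * r1 ^ 2 * (c * v ^ 2 - s * r2) * hε2 + s * r1 ^ 2 * r2 * hcs - s * r2 * hv2)
  · rw [hτ.dot_eq hu, ← ht]
    field_simp
    ring

/-- The equation `W_S = c` is, in terms of the profile, again the profile equation. -/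
lemma rotSurface_isWeingarten (hε : ε = 1 ∨ ε = -1) (ho : o ∈ spaceForm ε n) (hn : 1 ≤ n)
    (h : IsCSCProfile ε n C r) :
    IsWeingartenHypersurface ε (rotSurface ε o r) (scalarWeingarten ε)
      (n * (n - 1) * (C + ε)) := by
  obtain ⟨τ, σ, hτ⟩ := exists_conformalRadius h
  intro p hp
  obtain ⟨hu, hup⟩ := chart_chartInv (C := C) hε ho h hτ hp
  obtain ⟨α, β, hS, hα, hβ⟩ := shapeOperator_chart hε ho h hτ hu
  set u := chartInv ε o r τ p
  set t := chartHeight σ u with ht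
  obtain ⟨m, rfl⟩ := Nat.exists_eq_add_of_le' hn
  refine ⟨_, _, _, u, Fin.cons (α + β * (u ⬝ᵥ u)) fun _ => α,
    isLocalParametrization_chart hε ho h hτ, isUnitNormal_chartNormal hε ho h hτ, hu, hup, ?_, ?_⟩
  · rw [ArePrincipalCurvatures, hS, charpoly_smul_one_add_vecMulVec hn, Fin.prod_univ_succ]
    simp
  · have hθ : angle ε (chartNormal ε o r τ σ) u = deriv r t / speed r t := by
      simp [angle, prodForm, chartNormal, lift, form, ← ht]
    rw [scalarWeingarten, two_mul_sum_Ioi, hθ]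
    simp only [Fin.sum_univ_succ, Fin.cons_zero, Fin.cons_succ, Finset.sum_const, Finset.card_univ,
      Fintype.card_fin, nsmul_eq_mul]
    rw [hβ, hα]
    have hs := (h.sinE_pos t).ne'
    have hv := (speed_pos r t).ne'
    have hcs := cosE_sq_add hε (r t)
    have hv2 := speed_sq r t
    have hode := h.ode t
    rw [← hv2] at hode
    push_cast at hode ⊢
    rw [div_pow (deriv r t), show deriv r t ^ 2 = speed r t ^ 2 - 1 by linarith]
    field_simp
    linear_combination (-speed r t ^ 2 * m) * hode

end Curvature

/-! ### Topology of the hypersurface -/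

section Topology

variable {n : ℕ} {ε C : ℝ} {o : Fin (n + 1) → ℝ} {r : ℝ → ℝ}

/-- The direction of the frame in which a point of the hypersurface lies. -/
noncomputable def direction (ε : ℝ) (o : Fin (n + 1) → ℝ) (r : ℝ → ℝ) (p : Ambient n) :
    Fin n → ℝ :=
  (sinE ε (r p.2))⁻¹ • frameCoord ε o p.1

/-- The profile curve in the direction `v`, lifted to the hypersurface. -/
noncomputable def meridian (ε : ℝ) (o : Fin (n + 1) → ℝ) (r : ℝ → ℝ) (v : Fin n → ℝ) (t : ℝ) :
    Ambient n :=
  (cosE ε (r t) • o + frameEmb ε o (sinE ε (r t) • v), t)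

lemma direction_sq (hε : ε = 1 ∨ ε = -1) (ho : o ∈ spaceForm ε n) (h : IsCSCProfile ε n C r)
    {p : Ambient n} (hp : p ∈ rotSurface ε o r) :
    direction ε o r p ⬝ᵥ direction ε o r p = 1 := by
  have hs := (h.sinE_pos p.2).ne'
  rw [direction, smul_dotProduct, dotProduct_smul, frameCoord_sq_of_mem hε ho h.cosE_pos hp]
  simp only [smul_eq_mul]
  field_simp

lemma direction_meridian (hε : ε = 1 ∨ ε = -1) (ho : o ∈ spaceForm ε n)
    (h : IsCSCProfile ε n C r) (v : Fin n → ℝ) (t : ℝ) :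
    direction ε o r (meridian ε o r v t) = v := by
  simp only [direction, meridian]
  rw [frameCoord_comb hε ho, smul_smul, inv_mul_cancel₀ (h.sinE_pos t).ne', one_smul]

lemma meridian_direction (hε : ε = 1 ∨ ε = -1) (ho : o ∈ spaceForm ε n)
    (h : IsCSCProfile ε n C r) {p : Ambient n} (hp : p ∈ rotSurface ε o r) :
    meridian ε o r (direction ε o r p) p.2 = p := by
  conv_rhs => rw [eq_comb_of_mem hε ho hp]
  rw [meridian, direction, smul_smul, mul_inv_cancel₀ (h.sinE_pos p.2).ne', one_smul]

lemma meridian_mem (hε : ε = 1 ∨ ε = -1) (ho : o ∈ spaceForm ε n)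
    (h : IsCSCProfile ε n C r) {v : Fin n → ℝ} (hv : v ⬝ᵥ v = 1) (t : ℝ) :
    meridian ε o r v t ∈ rotSurface ε o r := by
  rw [meridian, comb_mem_rotSurface_iff hε ho h.cosE_pos, smul_dotProduct, dotProduct_smul, hv]
  simp [pow_two]

lemma nonempty_homeomorph_rotSurface (hε : ε = 1 ∨ ε = -1) (ho : o ∈ spaceForm ε n)
    (h : IsCSCProfile ε n C r) :
    Nonempty (rotSurface ε o r ≃ₜ (Metric.sphere (0 : EuclideanSpace ℝ (Fin n)) 1 × ℝ)) := by
  have hnorm : ∀ v : EuclideanSpace ℝ (Fin n), v ∈ Metric.sphere (0 : EuclideanSpace ℝ (Fin n)) 1 ↔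
      v.ofLp ⬝ᵥ v.ofLp = 1 := fun v => by
    rw [mem_sphere_zero_iff_norm, ← sq_eq_sq₀ (norm_nonneg v) zero_le_one, one_pow,
      EuclideanSpace.real_norm_sq_eq]
    simp [dotProduct, pow_two]
  have hsc := h.smooth_sinE.continuous
  have hcc := h.smooth_cosE.continuous
  refine ⟨{
    toFun := fun p => (⟨WithLp.toLp 2 (direction ε o r p.1),
      (hnorm _).2 (direction_sq hε ho h p.2)⟩, p.1.2)
    invFun := fun q => ⟨meridian ε o r q.1.1.ofLp q.2, meridian_mem hε ho h ((hnorm _).1 q.1.2) _⟩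
    left_inv := fun p => Subtype.ext (meridian_direction hε ho h p.2)
    right_inv := fun q => Prod.ext (Subtype.ext (by
      simp only [direction_meridian hε ho h])) rfl
    continuous_toFun := ?_
    continuous_invFun := ?_ }⟩
  · refine Continuous.prodMk (Continuous.subtype_mk ((PiLp.continuous_toLp 2 _).comp ?_) _)
      (continuous_snd.comp continuous_subtype_val)
    have h1 : Continuous fun p : Ambient n => (sinE ε (r p.2))⁻¹ :=
      (hsc.comp continuous_snd).inv₀ fun p => (h.sinE_pos p.2).ne'
    exact (h1.smul ((frameCoord ε o).continuous.comp continuous_fst)).comp continuous_subtype_val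
  · refine Continuous.subtype_mk ?_ _
    have h1 : Continuous fun q : Metric.sphere (0 : EuclideanSpace ℝ (Fin n)) 1 × ℝ =>
        q.1.1.ofLp :=
      (PiLp.continuous_ofLp 2 _).comp (continuous_subtype_val.comp continuous_fst)
    exact (((hcc.comp continuous_snd).smul continuous_const).add ((frameEmb ε o).continuous.comp
      ((hsc.comp continuous_snd).smul h1))).prodMk continuous_snd

end Topology

/-! ### Trajectories of the height gradient -/

section Trajectories

variable {n : ℕ} {ε C : ℝ} {o : Fin (n + 1) → ℝ} {r : ℝ → ℝ}

/-- The velocity of the meridian in the direction `v`. -/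
noncomputable def meridianVel (ε : ℝ) (o : Fin (n + 1) → ℝ) (r : ℝ → ℝ) (v : Fin n → ℝ) (t : ℝ) :
    Ambient n :=
  ((-ε * sinE ε (r t) * deriv r t) • o + frameEmb ε o ((cosE ε (r t) * deriv r t) • v), 1)

/-- The gradient of the height function of the hypersurface. -/
noncomputable def heightGrad (ε : ℝ) (o : Fin (n + 1) → ℝ) (r : ℝ → ℝ) (p : Ambient n) :
    Ambient n :=
  (speed r p.2 ^ 2)⁻¹ • meridianVel ε o r (direction ε o r p) p.2

lemma hasDerivAt_meridian (hε : ε = 1 ∨ ε = -1) (h : IsCSCProfile ε n C r) (v : Fin n → ℝ)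
    (t : ℝ) : HasDerivAt (meridian ε o r v) (meridianVel ε o r v t) t :=
  (((h.hasDerivAt_cosE hε t).smul_const o).add
    ((frameEmb ε o).hasFDerivAt.comp_hasDerivAt t ((h.hasDerivAt_sinE t).smul_const v))).prodMk
    (hasDerivAt_id t)

lemma heightGrad_fst (p : Ambient n) : (heightGrad ε o r p).1 =
    ((speed r p.2 ^ 2)⁻¹ * (-ε * sinE ε (r p.2) * deriv r p.2)) • o + frameEmb ε o
      (((speed r p.2 ^ 2)⁻¹ * (cosE ε (r p.2) * deriv r p.2)) • direction ε o r p) := by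
  simp [heightGrad, meridianVel, smul_smul, map_smul]

lemma heightGrad_snd (p : Ambient n) : (heightGrad ε o r p).2 = (speed r p.2 ^ 2)⁻¹ := by
  simp [heightGrad, meridianVel]

/-- The components of the velocity of a curve in the hypersurface. -/
lemma velocity_components (hε : ε = 1 ∨ ε = -1) (ho : o ∈ spaceForm ε n)
    (h : IsCSCProfile ε n C r) {γ : ℝ → Ambient n} (hγ : ∀ s, γ s ∈ rotSurface ε o r) {s : ℝ}
    {w : Ambient n} (hw : HasDerivAt γ w s) :
    form ε w.1 o = ε * (-ε * sinE ε (r (γ s).2) * deriv r (γ s).2 * w.2) ∧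
    direction ε o r (γ s) ⬝ᵥ frameCoord ε o w.1 =
      cosE ε (r (γ s).2) * deriv r (γ s).2 * w.2 := by
  have h1 : HasDerivAt (fun x => (γ x).1) w.1 s := hw.fst
  have h2 : HasDerivAt (fun x => (γ x).2) w.2 s := hw.snd
  have hs := (h.sinE_pos (γ s).2).ne'
  constructor
  · have hA : HasDerivAt (fun x => form ε (γ x).1 o) (form ε w.1 o) s :=
      (formL ε o).hasFDerivAt.comp_hasDerivAt s h1
    have hB : HasDerivAt (fun x => ε * cosE ε (r (γ x).2)) _ s :=
      (HasDerivAt.comp s (h₂ := fun t => cosE ε (r t)) (h.hasDerivAt_cosE hε (γ s).2) h2).const_mul ε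
    rw [funext fun x => (hγ x).2] at hA
    exact hA.unique hB
  · have hω : HasDerivAt (fun x => frameCoord ε o (γ x).1) (frameCoord ε o w.1) s :=
      (frameCoord ε o).hasFDerivAt.comp_hasDerivAt s h1
    have hA := (hasFDerivAt_dotProduct_self (frameCoord ε o (γ s).1)).comp_hasDerivAt s hω
    have hB : HasDerivAt (fun x => sinE ε (r (γ x).2) ^ 2) _ s :=
      (HasDerivAt.comp s (h₂ := fun t => sinE ε (r t)) (h.hasDerivAt_sinE (γ s).2) h2).pow 2
    have hfun : ((fun v : Fin n → ℝ => v ⬝ᵥ v) ∘ fun x => frameCoord ε o (γ x).1) =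
        fun x => sinE ε (r (γ x).2) ^ 2 :=
      funext fun x => frameCoord_sq_of_mem hε ho h.cosE_pos (hγ x)
    rw [hfun] at hA
    have := hA.unique hB
    simp at this
    rw [direction, smul_dotProduct, smul_eq_mul]
    field_simp
    linear_combination this / 2

lemma prodForm_decomp (hε : ε = 1 ∨ ε = -1) (ho : o ∈ spaceForm ε n) (v w : Ambient n) :
    prodForm ε v w = ε * form ε v.1 o * form ε w.1 o
      + frameCoord ε o v.1 ⬝ᵥ frameCoord ε o w.1 + v.2 * w.2 := by
  have hε2 : ε * ε = 1 := by rcases hε with rfl | rfl <;> norm_num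
  rw [prodForm]
  conv_lhs => rw [← frame_decomp hε ho v.1, ← frame_decomp hε ho w.1, form_comb hε ho]
  linear_combination (ε * form ε v.1 o * form ε w.1 o) * hε2

/-- The defining property of the gradient of the height function. -/
lemma prodForm_heightGrad (hε : ε = 1 ∨ ε = -1) (ho : o ∈ spaceForm ε n)
    (h : IsCSCProfile ε n C r) {p v : Ambient n} (hv : v ∈ tangentVectors (rotSurface ε o r) p) :
    prodForm ε (heightGrad ε o r p) v = v.2 := by
  have hε2 : ε ^ 2 = 1 := by rcases hε with rfl | rfl <;> norm_num
  obtain ⟨γ, hγ, rfl, hv⟩ := hv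
  obtain ⟨h1, h2⟩ := velocity_components hε ho h hγ hv
  rw [prodForm_decomp hε ho, heightGrad_fst, heightGrad_snd, form_comb_base hε ho,
    frameCoord_comb hε ho, h1, smul_dotProduct, h2, smul_eq_mul]
  have hcs := cosE_sq_add hε (r (γ 0).2)
  have hv2 := speed_sq r (γ 0).2
  have hv := (speed_pos r (γ 0).2).ne'
  field_simp
  linear_combination (v.2 * deriv r (γ 0).2 ^ 2) * hcs - v.2 * hv2
    + (v.2 * deriv r (γ 0).2 ^ 2 * ε * sinE ε (r (γ 0).2) ^ 2) * (ε ^ 2 + 1) * hε2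

lemma exists_trajectory_time (h : IsCSCProfile ε n C r) :
    ∃ T g : ℝ → ℝ, IsTimeChange (fun t => speed r t ^ 2) T g :=
  exists_timeChange (h.smooth_speed.pow 2) one_pos fun t => by
    rw [speed_sq]; linarith [sq_nonneg (deriv r t)]

/-- Meridians, reparametrized by `ds = (1 + r'²) dt`, are integral curves of `heightGrad`. -/
lemma hasDerivAt_meridian_comp (hε : ε = 1 ∨ ε = -1) (ho : o ∈ spaceForm ε n)
    (h : IsCSCProfile ε n C r) {T g : ℝ → ℝ} (hT : IsTimeChange (fun t => speed r t ^ 2) T g)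
    (v : Fin n → ℝ) (k s : ℝ) :
    HasDerivAt (fun x => meridian ε o r v (g (k + x)))
      (heightGrad ε o r (meridian ε o r v (g (k + s)))) s := by
  have h1 : HasDerivAt (fun x => g (k + x)) (speed r (g (k + s)) ^ 2)⁻¹ s := by
    simpa using (hT.hasDerivAt_inv (k + s)).comp_const_add k s
  have h2 := (hasDerivAt_meridian (o := o) hε h v (g (k + s))).scomp s h1
  rw [heightGrad, direction_meridian hε ho h]
  exact h2

lemma exists_isTTrajectory (hε : ε = 1 ∨ ε = -1) (ho : o ∈ spaceForm ε n)
    (h : IsCSCProfile ε n C r) {p : Ambient n} (hp : p ∈ rotSurface ε o r) :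
    ∃ γ : ℝ → Ambient n, γ 0 = p ∧ (∀ s, γ s ∈ rotSurface ε o r) ∧
      ∀ s, HasDerivAt γ (heightGrad ε o r (γ s)) s := by
  obtain ⟨T, g, hT⟩ := exists_trajectory_time h
  refine ⟨fun x => meridian ε o r (direction ε o r p) (g (T p.2 + x)), ?_, fun s => ?_, fun s =>
    hasDerivAt_meridian_comp hε ho h hT _ _ s⟩
  · simp only [add_zero, hT.left_inv, meridian_direction hε ho h hp]
  · exact meridian_mem hε ho h (direction_sq hε ho h hp) _

lemma isHeightGradient_heightGrad (hε : ε = 1 ∨ ε = -1) (ho : o ∈ spaceForm ε n)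
    (h : IsCSCProfile ε n C r) {p : Ambient n} (hp : p ∈ rotSurface ε o r) :
    IsHeightGradient ε (rotSurface ε o r) p (heightGrad ε o r p) := by
  obtain ⟨γ, h0, hm, hd⟩ := exists_isTTrajectory hε ho h hp
  refine ⟨⟨γ, hm, h0, ?_⟩, fun v hv => prodForm_heightGrad hε ho h hv⟩
  have := hd 0
  rwa [h0] at this

/-- The height gradient is unique since the form is positive definite on tangent vectors. -/
lemma IsHeightGradient.eq_heightGrad (hε : ε = 1 ∨ ε = -1) (ho : o ∈ spaceForm ε n)
    (h : IsCSCProfile ε n C r) {p w : Ambient n} (hp : p ∈ rotSurface ε o r)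
    (hw : IsHeightGradient ε (rotSurface ε o r) p w) : w = heightGrad ε o r p := by
  have hT := isHeightGradient_heightGrad hε ho h hp
  set T := heightGrad ε o r p
  have e1 := hw.2 w hw.1
  have e2 := hw.2 T hT.1
  have e3 := hT.2 w hw.1
  have e4 := hT.2 T hT.1
  have hsnd : w.2 = T.2 := by
    rw [← e2, ← e3]
    simp only [prodForm, form_comm w.1 T.1, mul_comm w.2]
  have hbase : form ε w.1 o = form ε T.1 o := by
    obtain ⟨γ₁, hγ₁, hγ₁0, hd₁⟩ := hw.1
    obtain ⟨γ₂, hγ₂, hγ₂0, hd₂⟩ := hT.1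
    rw [(velocity_components hε ho h hγ₁ hd₁).1, (velocity_components hε ho h hγ₂ hd₂).1, hγ₁0,
      hγ₂0, hsnd]
  have hcoord : frameCoord ε o w.1 = frameCoord ε o T.1 := by
    rw [prodForm_decomp hε ho] at e1 e2 e3 e4
    rw [← sub_eq_zero, ← dotProduct_self_eq_zero, sub_dotProduct, dotProduct_sub, dotProduct_sub]
    rw [hbase, hsnd] at e1 e3
    rw [hbase, hsnd] at e2
    linear_combination e1 - e2 - e3 + e4
  refine Prod.ext ?_ hsnd
  rw [← frame_decomp hε ho w.1, hbase, hcoord, frame_decomp hε ho]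

/-- Every complete integral curve of the height gradient sweeps out a whole meridian. -/
lemma range_isTTrajectory (hε : ε = 1 ∨ ε = -1) (ho : o ∈ spaceForm ε n)
    (h : IsCSCProfile ε n C r) {γ : ℝ → Ambient n}
    (hγ : IsTTrajectory ε (rotSurface ε o r) γ) :
    ∃ v : Fin n → ℝ, v ⬝ᵥ v = 1 ∧ Set.range γ = Set.range (meridian ε o r v) := by
  have hm : ∀ s, γ s ∈ rotSurface ε o r := fun s => (hγ s).1
  have hd : ∀ s, HasDerivAt γ (heightGrad ε o r (γ s)) s := fun s => by
    obtain ⟨-, w, hw, hg⟩ := hγ s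
    rwa [hg.eq_heightGrad hε ho h (hm s)] at hw
  have ht : ∀ s, HasDerivAt (fun x => (γ x).2) (speed r (γ s).2 ^ 2)⁻¹ s := fun s => by
    have : HasDerivAt (fun x => (γ x).2) (heightGrad ε o r (γ s)).2 s := (hd s).snd
    rwa [heightGrad_snd] at this
  have hdir : ∀ s, HasDerivAt (fun x => direction ε o r (γ x)) 0 s := fun s => by
    have h0 : HasDerivAt (fun x => (γ x).1) (heightGrad ε o r (γ s)).1 s := (hd s).fst
    have h1 := (frameCoord ε o).hasFDerivAt.comp_hasDerivAt s h0
    rw [heightGrad_fst, frameCoord_comb hε ho] at h1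
    have hs := (h.sinE_pos (γ s).2).ne'
    have h2 : HasDerivAt (fun x => (sinE ε (r (γ x).2))⁻¹) _ s :=
      (HasDerivAt.comp s (h₂ := fun t => sinE ε (r t)) (h.hasDerivAt_sinE (γ s).2) (ht s)).inv hs
    refine (h2.smul h1).congr_deriv ?_
    simp only [direction, Function.comp, smul_smul, ← add_smul]
    refine smul_eq_zero_of_left ?_ _
    have hv := (speed_pos r (γ s).2).ne'
    field_simp
    ring
  have hconst : ∀ s, direction ε o r (γ s) = direction ε o r (γ 0) := fun s =>
    is_const_of_deriv_eq_zero (fun x => (hdir x).differentiableAt) (fun x => (hdir x).deriv) s 0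
  obtain ⟨T, g, hT⟩ := exists_trajectory_time h
  have hTd : ∀ s, HasDerivAt (fun x => T (γ x).2 - x) 0 s := fun s => by
    have := ((hT.hasDerivAt (γ s).2).comp s (ht s)).sub (hasDerivAt_id s)
    refine this.congr_deriv ?_
    have hv := (speed_pos r (γ s).2).ne'
    field_simp
    ring
  have hTc : ∀ s, T (γ s).2 = s + T (γ 0).2 := fun s => by
    have := is_const_of_deriv_eq_zero (fun x => (hTd x).differentiableAt)
      (fun x => (hTd x).deriv) s 0
    linarith
  refine ⟨direction ε o r (γ 0), direction_sq hε ho h (hm 0), ?_⟩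
  ext p
  constructor
  · rintro ⟨s, rfl⟩
    exact ⟨(γ s).2, by rw [← hconst s, meridian_direction hε ho h (hm s)]⟩
  · rintro ⟨t, rfl⟩
    refine ⟨T t - T (γ 0).2, ?_⟩
    set s := T t - T (γ 0).2
    have hts : (γ s).2 = t := by
      rw [← hT.left_inv (γ s).2, hTc, sub_add_cancel, hT.left_inv]
    rw [← hconst s, ← hts, meridian_direction hε ho h (hm s)]

lemma isDelaunayType_rotSurface (hε : ε = 1 ∨ ε = -1) (ho : o ∈ spaceForm ε n)
    (h : IsCSCProfile ε n C r) (heven : ∀ t, r (-t) = r t) {a : ℝ} (ha : 0 < a)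
    (hper : ∀ t, r (t + 2 * a) = r t) (hmono : StrictMonoOn r (Set.Icc 0 a)) :
    IsDelaunayType ε o (rotSurface ε o r) := by
  refine ⟨⟨2 * a, by positivity, fun x t => ?_⟩, fun p hp => ?_, fun γ hγ => ?_⟩
  · simp only [rotSurface, Set.mem_ofPred_eq, hper]
  · obtain ⟨γ, h0, hm, hd⟩ := exists_isTTrajectory hε ho h hp
    exact ⟨γ, fun s => ⟨hm s, _, hd s, isHeightGradient_heightGrad hε ho h (hm s)⟩, h0⟩
  · obtain ⟨v, hv, hrange⟩ := range_isTTrajectory hε ho h hγ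
    refine ⟨frameEmb ε o v, r, 0, a, ?_, form_frameEmb_base hε ho v, ha, h.smooth, h.pos,
      h.lt_pi_div_two, hper, fun t => by simp [heven], by simpa using hmono, ?_⟩
    · rw [form_frameEmb_frameEmb hε ho, hv]
    · rw [hrange]
      congr 1
      funext t
      rw [meridian, map_smul]

end Trajectories

/-! ### The bound on the neck radius -/

section NeckRadius

open Filter Topology

variable {n : ℕ} {ε c : ℝ}

lemma sinE_lt_sinE {s t : ℝ} (hs : 0 < s) (hst : s < t) (ht : ε = 1 → t < Real.pi / 2) :
    sinE ε s < sinE ε t := by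
  unfold sinE
  split_ifs with h
  · exact Real.strictMonoOn_sin ⟨by linarith [Real.pi_pos], by linarith [ht h]⟩
      ⟨by linarith [Real.pi_pos], (ht h).le⟩ hst
  · exact Real.sinh_lt_sinh.2 hst

/-- The condition that defines `deltaE` is linear in `sin_ε²`. -/
lemma neck_condition_iff (hε : ε = 1 ∨ ε = -1) {C l : ℝ} (hl : 0 < l)
    (hl1 : ε = 1 → l < Real.pi / 2) :
    (n * C + 2 * ε) * tanE ε l ^ 2 < (n : ℝ) - 2 ↔ n * (C + ε) * sinE ε l ^ 2 < n - 2 := by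
  have hc := cosE_pos hl hl1
  have hcs := cosE_sq_add hε l
  rw [tanE_eq, div_pow, mul_div_assoc', div_lt_iff₀ (by positivity)]
  have hc2 : cosE ε l ^ 2 = 1 - ε * sinE ε l ^ 2 := by linarith
  rw [hc2]
  constructor <;> intro h <;> linarith

lemma deltaE_pos (hn : 3 ≤ n) : 0 < deltaE ε n c := by
  have hn' : (3 : ℝ) ≤ n := by exact_mod_cast hn
  have hcos : cosE ε 0 ≠ 0 := by unfold cosE; split_ifs <;> simp
  have hsin : sinE ε 0 = 0 := by unfold sinE; split_ifs <;> simp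
  have hcont : ContinuousAt (fun l => (n * constC ε n c + 2 * ε) * tanE ε l ^ 2) 0 := by
    simp only [tanE_eq]
    exact continuousAt_const.mul ((contDiff_sinE.continuous.continuousAt.div
      contDiff_cosE.continuous.continuousAt hcos).pow 2)
  have hev : ∀ᶠ l in 𝓝 (0 : ℝ), (n * constC ε n c + 2 * ε) * tanE ε l ^ 2 < (n : ℝ) - 2 := by
    refine hcont.eventually_lt_const ?_
    simp only [tanE_eq, hsin]
    norm_num
    linarith
  have hev2 : ∀ᶠ l in 𝓝 (0 : ℝ), l < Real.pi / 2 := eventually_lt_nhds (by positivity)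
  obtain ⟨l, ⟨h1, h2⟩, h3⟩ := (((hev.and hev2).filter_mono nhdsWithin_le_nhds).and
    (self_mem_nhdsWithin (a := (0 : ℝ)) (s := Set.Ioi 0))).exists
  have hl : (0 : ℝ) < l := h3
  exact lt_of_lt_of_le (EReal.coe_pos.2 hl) (le_sSup ⟨l, ⟨hl, fun _ => h2, h1⟩, rfl⟩)

lemma neck_condition_of_lt_deltaE (hε : ε = 1 ∨ ε = -1) (hn : 3 ≤ n) {l : ℝ} (hl : 0 < l)
    (h : (l : EReal) < deltaE ε n c) : (ε = 1 → l < Real.pi / 2) ∧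
      n * (constC ε n c + ε) * sinE ε l ^ 2 < n - 2 := by
  have hn' : (3 : ℝ) ≤ n := by exact_mod_cast hn
  obtain ⟨_, ⟨l', ⟨hl', hl'1, hcond⟩, rfl⟩, hlt⟩ := lt_sSup_iff.1 h
  have hll : l < l' := EReal.coe_lt_coe_iff.1 hlt
  have hl1 : ε = 1 → l < Real.pi / 2 := fun he => hll.trans (hl'1 he)
  refine ⟨hl1, ?_⟩
  rw [neck_condition_iff hε hl' hl'1] at hcond
  have hs := sinE_pos hl hl1
  have hs2 : sinE ε l ^ 2 < sinE ε l' ^ 2 :=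
    pow_lt_pow_left₀ (sinE_lt_sinE hl hll hl'1) hs.le (by norm_num)
  rcases le_total (n * (constC ε n c + ε)) 0 with hk | hk
  · nlinarith [sq_nonneg (sinE ε l)]
  · nlinarith

lemma eq_constC (hn : 3 ≤ n) : c = n * (n - 1) * (constC ε n c + ε) := by
  have hn' : (3 : ℝ) ≤ n := by exact_mod_cast hn
  have h1 : (n : ℝ) ≠ 0 := by positivity
  have h2 : (n : ℝ) - 1 ≠ 0 := by linarith
  rw [constC]
  field_simp
  ring

lemma constC_pos (hn : 3 ≤ n) (hc : ε * n * ((n : ℝ) - 1) < c) : 0 < constC ε n c := by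
  have hn' : (3 : ℝ) ≤ n := by exact_mod_cast hn
  exact div_pos (by linarith) (mul_pos (by linarith) (by linarith))

/-- Existence of the profile for every admissible neck radius. -/
lemma exists_profile (hε : ε = 1 ∨ ε = -1) (hn : 3 ≤ n) {C l : ℝ} (hC : 0 < C) (hl : 0 < l)
    (hl1 : ε = 1 → l < Real.pi / 2) (h : n * (C + ε) * sinE ε l ^ 2 < n - 2) :
    ∃ r : ℝ → ℝ, IsCSCProfile ε n C r ∧ r 0 = l ∧ (∀ t, l ≤ r t) ∧ (∀ t, r (-t) = r t) ∧
      (0 < C + ε → ∃ a : ℝ, 0 < a ∧ (∀ t, r (t + 2 * a) = r t) ∧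
        StrictMonoOn r (Set.Icc 0 a)) := by
  obtain ⟨m, rfl⟩ := Nat.exists_eq_add_of_le' hn
  by_cases hK : 0 < C + ε
  · have h' : (m + 3) * (C + ε) * sinE ε l ^ 2 < m + 1 := by
      push_cast at h; linarith
    obtain ⟨r, h1, h2, h3, h4, h5⟩ := exists_periodic_profile hε hC hK hl hl1 h'
    exact ⟨r, h1, h2, h3, h4, fun _ => h5⟩
  · obtain rfl : ε = -1 := hε.resolve_left (by rintro rfl; linarith)
    obtain ⟨r, h1, h2, h3, h4⟩ := exists_unbounded_profile (m := m) hC (by linarith) hl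
    exact ⟨r, h1, h2, h3, h4, fun h => absurd h hK⟩

end NeckRadius

end CSCAnnuli

theorem mainTheorem6 (n : ℕ) (hn : 3 ≤ n) (ε : ℝ) (hε : ε = 1 ∨ ε = -1) (c : ℝ)
    (hc : ε * n * ((n : ℝ) - 1) < c) (o : Fin (n + 1) → ℝ)
    (ho : o ∈ CSCAnnuli.spaceForm ε n) :
    0 < CSCAnnuli.deltaE ε n c ∧
    ∃ S : ℝ → Set (CSCAnnuli.Ambient n),
      ∀ l : ℝ, 0 < l → (l : EReal) < CSCAnnuli.deltaE ε n c →
        CSCAnnuli.IsProperlyEmbeddedHypersurface ε (S l) ∧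
        CSCAnnuli.IsRotational ε o (S l) ∧
        CSCAnnuli.IsWeingartenHypersurface ε (S l) (CSCAnnuli.scalarWeingarten ε) c ∧
        CSCAnnuli.HasConstantScalarCurvature ε (S l) c ∧
        Nonempty (S l ≃ₜ (Metric.sphere (0 : EuclideanSpace ℝ (Fin n)) 1 × ℝ)) ∧
        -- `l` is the distance to the axis, attained on the section at height `0`
        (∀ p ∈ S l, l ≤ CSCAnnuli.geoDist ε p.1 o) ∧
        (∀ x ∈ CSCAnnuli.spaceForm ε n, (x, (0 : ℝ)) ∈ S l ↔ CSCAnnuli.geoDist ε x o = l) ∧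
        ((ε = -1 ∧ 1 < CSCAnnuli.constC ε n c) ∨ ε = 1 →
          CSCAnnuli.IsDelaunayType ε o (S l)) ∧
        (ε = -1 ∧ CSCAnnuli.constC ε n c ≤ 1 →
          (∀ x t, (x, -t) ∈ S l ↔ (x, t) ∈ S l) ∧
          ¬ Bornology.IsBounded (Prod.snd '' S l)) := by
  open CSCAnnuli in
  refine ⟨deltaE_pos hn, ?_⟩
  have hC := constC_pos hn hc
  suffices H : ∀ l : ℝ, ∃ r : ℝ → ℝ, 0 < l → (l : EReal) < deltaE ε n c →
      IsCSCProfile ε n (constC ε n c) r ∧ r 0 = l ∧ (∀ t, l ≤ r t) ∧ (∀ t, r (-t) = r t) ∧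
      (0 < constC ε n c + ε → ∃ a : ℝ, 0 < a ∧ (∀ t, r (t + 2 * a) = r t) ∧
        StrictMonoOn r (Set.Icc 0 a)) by
    choose r hr using H
    refine ⟨fun l => rotSurface ε o (r l), fun l hl hlδ => ?_⟩
    obtain ⟨hp, h0, hle, heven, hper⟩ := hr l hl hlδ
    have hpi : ∀ t, ε = 1 → r l t ≤ Real.pi := fun t he => by
      linarith [hp.lt_pi_div_two he t, Real.pi_pos]
    refine ⟨isProperlyEmbedded_rotSurface hε ho hp, isRotational_rotSurface hε ho hp, ?_, ?_,
      nonempty_homeomorph_rotSurface hε ho hp, fun p hpS => ?_, fun x hx => ?_, fun hcase => ?_,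
      fun _ => ⟨fun x t => ?_, ?_⟩⟩
    · rw [eq_constC (ε := ε) (c := c) hn]
      exact rotSurface_isWeingarten hε ho (by omega) hp
    · rw [eq_constC (ε := ε) (c := c) hn]
      exact chart_hasConstantScalarCurvature hε ho hp
    · rw [(geoDist_eq_iff hε ho hpS.1 (hp.pos p.2).le (hpi p.2)).2 hpS.2]
      exact hle p.2
    · have hiff := geoDist_eq_iff hε ho hx (hp.pos 0).le (hpi 0)
      change x ∈ spaceForm ε n ∧ form ε x o = ε * cosE ε (r l 0) ↔ _
      rw [← hiff, h0, and_iff_right hx]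
    · have hK : 0 < constC ε n c + ε := by
        rcases hcase with ⟨rfl, h1⟩ | rfl <;> linarith
      obtain ⟨a, ha, hper, hmono⟩ := hper hK
      exact isDelaunayType_rotSurface hε ho hp heven ha hper hmono
    · simp only [rotSurface, Set.mem_ofPred_eq, heven]
    · have huniv : Prod.snd '' rotSurface ε o (r l) = Set.univ := by
        refine Set.eq_univ_of_forall fun t => ?_
        have hv : (Pi.single ⟨0, by omega⟩ 1 : Fin n → ℝ) ⬝ᵥ Pi.single ⟨0, by omega⟩ 1 = 1 := by
          simp
        exact ⟨_, meridian_mem hε ho hp hv t, rfl⟩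
      rw [huniv]
      exact NormedSpace.unbounded_univ ℝ ℝ
  intro l
  by_cases hl : 0 < l ∧ (l : EReal) < deltaE ε n c
  · obtain ⟨hl1, hcond⟩ := neck_condition_of_lt_deltaE hε hn hl.1 hl.2
    obtain ⟨r, hr⟩ := exists_profile hε hn hC hl.1 hl1 hcond
    exact ⟨r, fun _ _ => hr⟩
  -- outside the range of neck radii nothing is claimed
  · exact ⟨0, fun h1 h2 => absurd ⟨h1, h2⟩ hl⟩
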